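/- All Hilbert spaces are finite-dimensional, $|A|$ denotes the dimension of $A$, and $\log$ is the natural logarithm. Let $\mathcal N=\mathcal N_{A\to B}$ be a quantum channel (a completely positive trace-preserving linear map from the operators on $A$ to the operators on $B$), let $R\simeq A$, let $\rho_R$ be a quantum state on $R$ (a positive semidefinite operator of trace $1$), and let $M\ge 1$ be an integer. Let $v$ be the number of distinct eigenvalues of $\rho_R$ (the eigenvalue $0$, if present, is counted), and assume that $\log|A|\ge e^2$. Let $J_{\mathcal N}=\sum_{i,j=1}^{|A|}|i\rangle\langle j|_R\otimes\mathcal N(|i\rangle\langle j|)_B$ be the Choi matrix of $\mathcal N$ and define $$\mathrm{Suc}^{\mathrm{NS}}(\mathcal N,M,\rho)=\sup_{\Lambda_{RB}}\Big\{\operatorname{Tr}[\Lambda_{RB}J_{\mathcal N}]\;:\;\operatorname{Tr}_R\Lambda_{RB}=\tfrac1M\mathbb I_B,\ 0\preccurlyeq\Lambda_{RB}\preccurlyeq\rho_R\otimes\mathbb I_B\Big\}.$$ An entanglement-assisted code with $M$ messages consists of a pure state $\Psi$ on $E_A\otimes E_B$ with $E_A,E_B$ of arbitrary finite dimension, encoding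 channels $\mathcal E^m_{E_A\to A}$ for $m\in\{1,\dots,M\}$, and a POVM $\{\Xi^m\}_{m=1}^M$ on $B\otimes E_B$. Let $$\mathrm{Suc}^{\mathrm{EA}}(\mathcal N,M)=\sup\ \frac1M\sum_{m=1}^M\operatorname{Tr}\Big[\Xi^m\,(\mathcal N\otimes\mathrm{id}_{E_B})\big((\mathcal E^m\otimes\mathrm{id}_{E_B})(\Psi)\big)\Big],$$ where the supremum is over all such codes. Then $$\mathrm{Suc}^{\mathrm{EA}}(\mathcal N,M)\ \ge\ \frac{1}{2v\,\log\!\big(2v\,M\,e^{v}\,|A|^{v}\,|B|\big)}\cdot\mathrm{Suc}^{\mathrm{NS}}(\mathcal N,M,\rho).$$ -/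

import Mathlib

open scoped Kronecker ComplexOrder

namespace QCoding

/-- The map `Φ ⊗ id_E` on operators on `A ⊗ E`: `Φ` acts on each `A`-block, and the `E`-indices
are left alone. The space `ℂ^A` with its canonical basis is represented by the index type `A`. -/
def tensorId {A B : Type*} (E : Type*)
    (Φ : Matrix A A ℂ →ₗ[ℂ] Matrix B B ℂ) (X : Matrix (A × E) (A × E) ℂ) :
    Matrix (B × E) (B × E) ℂ :=
  Matrix.of fun p q => Φ (Matrix.of fun a a' => X (a, p.2) (a', q.2)) p.1 q.1

/-- Quantum channels: completely positive trace-preserving linear maps. -/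
structure IsChannel {A B : Type*} [Fintype A] [Fintype B]
    (Φ : Matrix A A ℂ →ₗ[ℂ] Matrix B B ℂ) : Prop where
  completelyPositive : ∀ (k : ℕ) (X : Matrix (A × Fin k) (A × Fin k) ℂ),
    X.PosSemidef → (tensorId (Fin k) Φ X).PosSemidef
  tracePreserving : ∀ X : Matrix A A ℂ, (Φ X).trace = X.trace

/-- Quantum states: positive semidefinite operators of trace one. -/
structure IsState {A : Type*} [Fintype A] (ρ : Matrix A A ℂ) : Prop where
  posSemidef : ρ.PosSemidef
  trace_eq_one : ρ.trace = 1

/-- The Choi matrix `∑ i j, |i⟩⟨j| ⊗ Φ(|i⟩⟨j|)` on `R ⊗ B`, where `R` is a copy of `A`. -/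
def choi {A B : Type*} [Fintype A] [DecidableEq A]
    (Φ : Matrix A A ℂ →ₗ[ℂ] Matrix B B ℂ) : Matrix (A × B) (A × B) ℂ :=
  ∑ i : A, ∑ j : A, Matrix.single i j (1 : ℂ) ⊗ₖ Φ (Matrix.single i j 1)

/-- The marginal on `B` of an operator on `R ⊗ B` (partial trace over `R`). -/
def traceOutLeft {R B : Type*} [Fintype R] (X : Matrix (R × B) (R × B) ℂ) : Matrix B B ℂ :=
  Matrix.of fun b b' => ∑ r : R, X (r, b) (r, b')

/-- The rank-one operator `|ψ⟩⟨ψ|`. -/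
def ketbra {E : Type*} (ψ : EuclideanSpace ℂ E) : Matrix E E ℂ :=
  Matrix.of fun x y => ψ x * star (ψ y)

/-- An entanglement-assisted code with `M` messages for channels from `A` to `B`: a shared pure
state on `E_A ⊗ E_B` (of arbitrary finite dimensions), one encoding channel `E_A → A` for each
message, and a decoding POVM on `B ⊗ E_B` with outcomes in the set of messages. -/
structure EACode (A B : Type*) [Fintype A] [Fintype B] [DecidableEq B] (M : ℕ) where
  dimEA : ℕ
  dimEB : ℕ
  Ψ : EuclideanSpace ℂ (Fin dimEA × Fin dimEB)
  norm_Ψ : ‖Ψ‖ = 1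
  enc : Fin M → Matrix (Fin dimEA) (Fin dimEA) ℂ →ₗ[ℂ] Matrix A A ℂ
  enc_isChannel : ∀ m, IsChannel (enc m)
  dec : Fin M → Matrix (B × Fin dimEB) (B × Fin dimEB) ℂ
  dec_posSemidef : ∀ m, (dec m).PosSemidef
  dec_sum : ∑ m, dec m = 1

section

variable {A B : Type*} [Fintype A] [Fintype B] [DecidableEq B] {M : ℕ}

/-- The probability that message `m` is decoded correctly when the code `C` is used over `N`. -/
noncomputable def EACode.successProbOf (C : EACode A B M)
    (N : Matrix A A ℂ →ₗ[ℂ] Matrix B B ℂ) (m : Fin M) : ℝ :=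
  (C.dec m * tensorId (Fin C.dimEB) N
    (tensorId (Fin C.dimEB) (C.enc m) (ketbra C.Ψ))).trace.re

/-- The average success probability of the code `C` over the channel `N`. -/
noncomputable def EACode.successProb (C : EACode A B M)
    (N : Matrix A A ℂ →ₗ[ℂ] Matrix B B ℂ) : ℝ :=
  (1 / (M : ℝ)) * ∑ m : Fin M, C.successProbOf N m

end

/-- The one-shot entanglement-assisted success probability: the supremum of the average success
probability over all entanglement-assisted codes with `M` messages. -/
noncomputable def sucEA {A B : Type*} [Fintype A] [Fintype B] [DecidableEq B]
    (N : Matrix A A ℂ →ₗ[ℂ] Matrix B B ℂ) (M : ℕ) : ℝ :=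
  sSup (Set.range fun C : EACode A B M => C.successProb N)

/-- Feasibility of `Λ` for the non-signaling program at a fixed input state `ρ`:
`Λ_B = (1/M) 1_B` and `0 ≤ Λ ≤ ρ ⊗ 1_B` in the Loewner order. -/
structure NSFeasible {A B : Type*} [Fintype A] [Fintype B] [DecidableEq B]
    (M : ℕ) (ρ : Matrix A A ℂ) (Λ : Matrix (A × B) (A × B) ℂ) : Prop where
  marginal : traceOutLeft Λ = (1 / (M : ℂ)) • (1 : Matrix B B ℂ)
  nonneg : Λ.PosSemidef
  le : (ρ ⊗ₖ (1 : Matrix B B ℂ) - Λ).PosSemidef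

/-- The value of the non-signaling program at a fixed input state `ρ`: the supremum of
`Tr[Λ J_N]` over all feasible `Λ`. -/
noncomputable def sucNS {A B : Type*} [Fintype A] [DecidableEq A] [Fintype B] [DecidableEq B]
    (N : Matrix A A ℂ →ₗ[ℂ] Matrix B B ℂ) (M : ℕ) (ρ : Matrix A A ℂ) : ℝ :=
  sSup {s : ℝ | ∃ Λ : Matrix (A × B) (A × B) ℂ, NSFeasible M ρ Λ ∧ s = (Λ * choi N).trace.re}

/-- The number of distinct eigenvalues of a matrix (zero is counted if it is an eigenvalue). -/
noncomputable def numEigenvalues {A : Type*} [Fintype A] [DecidableEq A]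
    (ρ : Matrix A A ℂ) : ℕ :=
  (spectrum ℂ ρ).ncard

end QCoding

/-!
A feasible operator `Λ` is rounded to an entanglement-assisted code by random coding.

The eigenspaces of `ρ` split `ℂ^A` into `v` blocks, on each of which `ρ` is a multiple `λ_j` of the
identity. By the pinching inequality (`re_trace_mul_le_card_mul_sum`), replacing `Λ` by its
block-diagonal part costs at most a factor `v` in the value. Sender and receiver share one maximally
entangled state for each block. For each message a block is drawn with probability `Tr (ρ Q_j)`,
together with a uniform generalized Pauli operator `U` on it; the sender feeds the rotated half of
that block into the channel, and the receiver measures the effect `(U† Λ_jj U) / λ_j` on the channel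
output and the other half. Feasibility makes this an effect, its mean over the draw is
`Tr_R Λ = 1 / M` (`sum_conj_design`, `sum_traceOutRight_compress`), and its mean success probability
is the value of the block-diagonal part of `Λ` (`le_sucEA_of_resolution`).

The effects of the `M` messages therefore sum to the identity on average, and the matrix Chernoff
bound shows that their sum is at most `L` times the identity, with `L` the logarithm in the theorem,
outside an event too rare to matter. Dividing the effects by `L` gives the decoder. The Chernoff
bound is used in a derandomized form (`exists_samples`), where the samples are picked greedily
against the penalty `Tr exp`; it rests on the Golden–Thompson inequality (`re_trace_exp_add_le`),
proved here from trace inequalities for dyadic powers and the Lie product formula.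

The failure bound is only useful if the value of `Λ` is at least `1 / M`; operators below that are
dominated by `ρ ⊗ 1 / M`, which has value exactly `1 / M`.
-/

namespace QCoding

open NormedSpace Filter Topology

/-! ### The Lie product formula -/

section Trotter

variable {𝔸 : Type*} [NormedRing 𝔸] [NormOneClass 𝔸]

theorem norm_exp_le_exp_norm [NormedAlgebra ℝ 𝔸] [CompleteSpace 𝔸] (x : 𝔸) : ‖exp x‖ ≤ Real.exp ‖x‖ := by
  rw [Real.exp_eq_exp_ℝ, exp_eq_tsum ℝ, exp_eq_tsum ℝ]
  refine tsum_of_norm_bounded (expSeries_summable' (𝕂 := ℝ) ‖x‖).hasSum fun n => ?_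
  rw [norm_smul, smul_eq_mul, Real.norm_of_nonneg (by positivity)]
  gcongr
  exact norm_pow_le x n

theorem norm_pow_sub_pow_le {a b : 𝔸} {K : ℝ} (ha : ‖a‖ ≤ K) (hb : ‖b‖ ≤ K) (hK : 0 ≤ K) (n : ℕ) :
    ‖a ^ (n + 1) - b ^ (n + 1)‖ ≤ (n + 1) * K ^ n * ‖a - b‖ := by
  induction n with
  | zero => simp
  | succ n ih =>
    have e : a ^ (n + 1 + 1) - b ^ (n + 1 + 1)
        = a ^ (n + 1) * (a - b) + (a ^ (n + 1) - b ^ (n + 1)) * b := by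
      rw [pow_succ a (n + 1), pow_succ b (n + 1)]; noncomm_ring
    rw [e]
    calc _ ≤ ‖a ^ (n + 1)‖ * ‖a - b‖ + ‖a ^ (n + 1) - b ^ (n + 1)‖ * ‖b‖ :=
          (norm_add_le _ _).trans (add_le_add (norm_mul_le _ _) (norm_mul_le _ _))
      _ ≤ K ^ (n + 1) * ‖a - b‖ + ((n + 1) * K ^ n * ‖a - b‖) * K := by
          gcongr
          exact (norm_pow_le _ _).trans (by gcongr)
      _ = _ := by push_cast; ring

/-- The **Lie product formula**. -/
theorem tendsto_exp_mul_exp_pow [NormedAlgebra ℝ 𝔸] [CompleteSpace 𝔸] (X Y : 𝔸) :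
    Tendsto (fun n : ℕ => (exp ((n + 1 : ℝ)⁻¹ • X) * exp ((n + 1 : ℝ)⁻¹ • Y)) ^ (n + 1))
      atTop (𝓝 (exp (X + Y))) := by
  let _ : NormedAlgebra ℚ 𝔸 := NormedAlgebra.restrictScalars ℚ ℝ 𝔸
  have hd (Z : 𝔸) : HasDerivAt (fun t : ℝ => exp (t • Z)) Z 0 := by
    simpa using hasDerivAt_exp_smul_const (𝕂 := ℝ) Z (0 : ℝ)
  -- The two one-parameter curves agree to first order at `0`.
  have h0 : HasDerivAt (fun t : ℝ => exp (t • X) * exp (t • Y) - exp (t • (X + Y))) 0 0 := by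
    exact (((hd X).fun_mul (hd Y)).fun_sub (hd (X + Y))).congr_deriv (by simp)
  have ht : Tendsto (fun n : ℕ => ((n : ℝ) + 1)⁻¹) atTop (𝓝[≠] 0) := by
    refine tendsto_nhdsWithin_iff.2 ⟨?_, Eventually.of_forall fun n => ?_⟩
    · simpa using tendsto_one_div_add_atTop_nhds_zero_nat (𝕜 := ℝ)
    · simp only [Set.mem_compl_iff, Set.mem_singleton_iff]; positivity
  have hs := (hasDerivAt_iff_tendsto_slope.1 h0).comp ht
  have hn := (tendsto_norm_zero.comp hs).mul_const (Real.exp (‖X‖ + ‖Y‖))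
  rw [zero_mul] at hn
  rw [tendsto_iff_norm_sub_tendsto_zero]
  refine squeeze_zero (fun _ => norm_nonneg _) (fun n => ?_) hn
  set t : ℝ := ((n : ℝ) + 1)⁻¹ with htd
  have htp : 0 < t := by positivity
  set K := Real.exp (t * (‖X‖ + ‖Y‖)) with hK
  have ha : ‖exp (t • X) * exp (t • Y)‖ ≤ K := by
    refine (norm_mul_le _ _).trans ?_
    rw [hK, mul_add, Real.exp_add]
    gcongr <;> refine (norm_exp_le_exp_norm _).trans_eq ?_ <;>
      rw [norm_smul, Real.norm_of_nonneg htp.le]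
  have hb : ‖exp (t • (X + Y))‖ ≤ K := by
    refine (norm_exp_le_exp_norm _).trans (Real.exp_le_exp.2 ?_)
    rw [norm_smul, Real.norm_of_nonneg htp.le]
    gcongr
    exact norm_add_le _ _
  have hpow : exp (X + Y) = exp (t • (X + Y)) ^ (n + 1) := by
    rw [← exp_nsmul, ← Nat.cast_smul_eq_nsmul ℝ, smul_smul]
    have : ((n + 1 : ℕ) : ℝ) * t = 1 := by push_cast; rw [htd]; field_simp
    rw [this, one_smul]
  rw [hpow]
  refine (norm_pow_sub_pow_le ha hb (Real.exp_pos _).le n).trans ?_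
  have hKn : K ^ n ≤ Real.exp (‖X‖ + ‖Y‖) := by
    rw [hK, ← Real.exp_nat_mul, Real.exp_le_exp, ← mul_assoc]
    refine mul_le_of_le_one_left (by positivity) ?_
    rw [htd, ← div_eq_mul_inv, div_le_one (by positivity)]
    linarith
  have : ‖slope (fun t : ℝ => exp (t • X) * exp (t • Y) - exp (t • (X + Y))) 0 t‖
      = (n + 1) * ‖exp (t • X) * exp (t • Y) - exp (t • (X + Y))‖ := by
    simp only [slope, vsub_eq_sub, zero_smul, exp_zero, mul_one, sub_self, sub_zero, norm_smul]
    rw [norm_inv, Real.norm_of_nonneg htp.le, htd, inv_inv]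
  simp only [Function.comp_apply]
  rw [this]
  calc _ = ((n : ℝ) + 1) * ‖exp (t • X) * exp (t • Y) - exp (t • (X + Y))‖ * K ^ n := by ring
    _ ≤ _ := by gcongr

end Trotter

/-! ### The Golden–Thompson inequality -/

section GoldenThompson

open Matrix

variable {n : Type*} [Fintype n]

theorem trace_mul_pow_comm [DecidableEq n] (X Y : Matrix n n ℂ) (m : ℕ) :
    ((X * Y) ^ m).trace = ((Y * X) ^ m).trace := by
  cases m with
  | zero => simp
  | succ m =>
    have h : (X * Y) ^ m * X = X * (Y * X) ^ m := by
      induction m with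
      | zero => simp
      | succ m ih => rw [pow_succ', mul_assoc, ih, pow_succ']; simp only [mul_assoc]
    rw [pow_succ, ← mul_assoc, h, trace_mul_comm, ← mul_assoc, ← pow_succ']

theorem two_mul_re_trace_mul_le (X Y : Matrix n n ℂ) :
    2 * (X * Y).trace.re ≤ (X * Xᴴ).trace.re + (Yᴴ * Y).trace.re := by
  have h := (posSemidef_self_mul_conjTranspose (X - Yᴴ)).trace_nonneg
  have h' := (Complex.le_def.1 h).1
  have hXY : (Yᴴ * Xᴴ).trace.re = (X * Y).trace.re := by
    rw [← conjTranspose_mul, trace_conjTranspose]; simp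
  simp only [conjTranspose_sub, conjTranspose_conjTranspose, Matrix.sub_mul, Matrix.mul_sub,
    trace_sub, Complex.sub_re, Complex.zero_re] at h'
  linarith

/-- The two inequalities for traces of dyadic powers are proved together, each feeding the
induction step of the other. -/
theorem re_trace_two_pow_le [DecidableEq n] (k : ℕ) :
    (∀ A B : Matrix n n ℂ, A.IsHermitian → B.IsHermitian →
      ((A * B) ^ 2 ^ k).trace.re ≤ (A ^ 2 ^ k * B ^ 2 ^ k).trace.re) ∧
    ∀ W : Matrix n n ℂ, (W ^ 2 ^ (k + 1)).trace.re ≤ ((W * Wᴴ) ^ 2 ^ k).trace.re := by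
  induction k with
  | zero =>
    refine ⟨fun A B _ _ => by simp, fun W => ?_⟩
    have := two_mul_re_trace_mul_le W W
    rw [trace_mul_comm Wᴴ W] at this
    simp only [zero_add, pow_one, pow_zero, sq]
    linarith
  | succ k ih =>
    obtain ⟨hD, hE⟩ := ih
    constructor
    · intro A B hA hB
      refine (hE (A * B)).trans ?_
      rw [conjTranspose_mul, hA.eq, hB.eq]
      rw [show A * B * (B * A) = A * (B * B * A) by noncomm_ring, trace_mul_pow_comm,
        show B * B * A * A = B ^ 2 * A ^ 2 by noncomm_ring, trace_mul_pow_comm]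
      refine (hD _ _ (hA.pow 2) (hB.pow 2)).trans_eq ?_
      rw [← pow_mul, ← pow_mul, ← pow_succ']
    · intro W
      have e : W ^ 2 ^ (k + 1 + 1) = (W ^ 2) ^ 2 ^ (k + 1) := by rw [← pow_mul, ← pow_succ']
      rw [e]
      refine (hE (W ^ 2)).trans ?_
      have hP : (Wᴴ * W).IsHermitian := isHermitian_conjTranspose_mul_self W
      have hQ : (W * Wᴴ).IsHermitian := isHermitian_mul_conjTranspose_self W
      rw [conjTranspose_pow, show W ^ 2 * Wᴴ ^ 2 = W * (W * Wᴴ * Wᴴ) by noncomm_ring,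
        trace_mul_pow_comm, show W * Wᴴ * Wᴴ * W = W * Wᴴ * (Wᴴ * W) by noncomm_ring]
      refine (hD _ _ hQ hP).trans ?_
      have := two_mul_re_trace_mul_le ((W * Wᴴ) ^ 2 ^ k) ((Wᴴ * W) ^ 2 ^ k)
      rw [(hQ.pow _).eq, (hP.pow _).eq, ← pow_add, ← pow_add, ← two_mul, ← pow_succ',
        trace_mul_pow_comm Wᴴ W] at this
      linarith

open scoped Norms.Operator in
theorem tendsto_matrix_exp_mul_exp_pow [DecidableEq n] (X Y : Matrix n n ℂ) :
    Tendsto (fun m : ℕ => (exp ((m + 1 : ℝ)⁻¹ • X) * exp ((m + 1 : ℝ)⁻¹ • Y)) ^ (m + 1))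
      atTop (𝓝 (exp (X + Y))) := by
  cases isEmpty_or_nonempty n
  · exact tendsto_const_nhds.congr fun _ => Subsingleton.elim _ _
  · exact tendsto_exp_mul_exp_pow X Y

/-- The **Golden–Thompson inequality**. -/
theorem re_trace_exp_add_le [DecidableEq n] {X Y : Matrix n n ℂ} (hX : X.IsHermitian) (hY : Y.IsHermitian) :
    (exp (X + Y)).trace.re ≤ (exp X * exp Y).trace.re := by
  have h2 : Tendsto (fun k : ℕ => 2 ^ k - 1) atTop atTop := by
    refine tendsto_atTop_mono (fun k => ?_) tendsto_id
    have := k.lt_two_pow_self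
    simp only [id]; omega
  have hc : Continuous fun Z : Matrix n n ℂ => Z.trace.re := by fun_prop
  refine le_of_tendsto ((hc.tendsto _).comp ((tendsto_matrix_exp_mul_exp_pow X Y).comp h2))
    (Eventually.of_forall fun k => ?_)
  simp only [Function.comp_apply]
  have e : 2 ^ k - 1 + 1 = 2 ^ k := Nat.sub_add_cancel Nat.one_le_two_pow
  have e' : (((2 ^ k - 1 : ℕ) : ℝ) + 1) = ((2 ^ k : ℕ) : ℝ) := by
    rw [← e]; push_cast; simp
  have hp (Z : Matrix n n ℂ) : exp ((((2 ^ k : ℕ) : ℝ))⁻¹ • Z) ^ 2 ^ k = exp Z := by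
    rw [← Matrix.exp_nsmul, ← Nat.cast_smul_eq_nsmul ℝ, smul_smul, mul_inv_cancel₀ (by positivity),
      one_smul]
  have hh {Z : Matrix n n ℂ} (hZ : Z.IsHermitian) (c : ℝ) : (exp (c • Z)).IsHermitian :=
    Matrix.IsHermitian.exp (by
      rw [Matrix.IsHermitian, conjTranspose_smul, hZ.eq]; simp)
  rw [e, e']
  refine ((re_trace_two_pow_le k).1 _ _ (hh hX _) (hh hY _)).trans_eq ?_
  rw [hp, hp]

end GoldenThompson

/-! ### A derandomized matrix Chernoff bound -/

section Chernoff

open Matrix Finset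

variable {n : Type*}

theorem posSemidef_real_smul {P : Matrix n n ℂ} (hP : P.PosSemidef) {c : ℝ} (hc : 0 ≤ c) :
    (c • P).PosSemidef := by
  have := hP.smul (Complex.zero_le_real.2 hc)
  rwa [Complex.coe_smul] at this

variable [Fintype n]

open scoped MatrixOrder in
theorem re_trace_mul_nonneg {P Q : Matrix n n ℂ} (hP : P.PosSemidef) (hQ : Q.PosSemidef) :
    0 ≤ (P * Q).trace.re := by
  classical
  obtain ⟨b, rfl⟩ := CStarAlgebra.nonneg_iff_eq_star_mul_self.mp hQ.nonneg
  rw [← Matrix.mul_assoc, trace_mul_comm, ← Matrix.mul_assoc]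
  exact (Complex.le_def.1 (hP.mul_mul_conjTranspose_same b).trace_nonneg).1

theorem re_trace_mul_le {P Q R : Matrix n n ℂ} (hP : P.PosSemidef) (h : (R - Q).PosSemidef) :
    (P * Q).trace.re ≤ (P * R).trace.re := by
  have := re_trace_mul_nonneg hP h
  rw [Matrix.mul_sub, trace_sub, Complex.sub_re] at this
  linarith

variable [DecidableEq n]

theorem eq_conj_diagonal_of_isHermitian {T : Matrix n n ℂ} (hT : T.IsHermitian) :
    T = (hT.eigenvectorUnitary : Matrix n n ℂ) * diagonal (fun i => (hT.eigenvalues i : ℂ)) *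
      (hT.eigenvectorUnitary : Matrix n n ℂ)ᴴ := by
  conv_lhs => rw [hT.spectral_theorem, Unitary.conjStarAlgAut_apply]
  rfl

theorem unitary_mul_conjTranspose (U : Matrix.unitaryGroup n ℂ) :
    (U : Matrix n n ℂ) * (U : Matrix n n ℂ)ᴴ = 1 ∧ (U : Matrix n n ℂ)ᴴ * (U : Matrix n n ℂ) = 1 :=
  ⟨Unitary.coe_mul_star_self U, Unitary.coe_star_mul_self U⟩

theorem exp_smul_eq_conj_diagonal {T : Matrix n n ℂ} (hT : T.IsHermitian) (θ : ℝ) :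
    exp (θ • T) = (hT.eigenvectorUnitary : Matrix n n ℂ) *
      diagonal (fun i => (Real.exp (θ * hT.eigenvalues i) : ℂ)) *
      (hT.eigenvectorUnitary : Matrix n n ℂ)ᴴ := by
  obtain ⟨h1, h2⟩ := unitary_mul_conjTranspose hT.eigenvectorUnitary
  set U := (hT.eigenvectorUnitary : Matrix n n ℂ)
  have hinv : U⁻¹ = Uᴴ := inv_eq_right_inv h1
  have e : θ • T = U * diagonal (fun i => ((θ * hT.eigenvalues i : ℝ) : ℂ)) * U⁻¹ := by
    conv_lhs => rw [eq_conj_diagonal_of_isHermitian hT]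
    rw [hinv, ← Matrix.smul_mul, ← Matrix.mul_smul, ← diagonal_smul]
    congr 3
    ext i; simp
  rw [e, Matrix.exp_conj _ _ (IsUnit.of_mul_eq_one _ h1), Matrix.exp_diagonal, hinv]
  congr 3
  ext i
  simp [Complex.exp_eq_exp_ℂ]

theorem posSemidef_exp {T : Matrix n n ℂ} (hT : T.IsHermitian) : (exp T).PosSemidef := by
  have h := exp_smul_eq_conj_diagonal hT 1
  rw [one_smul] at h
  rw [h]
  refine PosSemidef.mul_mul_conjTranspose_same (PosSemidef.diagonal fun i => ?_) _
  exact Complex.zero_le_real.2 (Real.exp_pos _).le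

/-- The chord bound `exp (θ t) ≤ 1 + (exp θ - 1) t` on `[0, 1]`, lifted to matrices. -/
theorem posSemidef_chord_sub_exp {T : Matrix n n ℂ} (hT : T.PosSemidef) (hT1 : (1 - T).PosSemidef)
    (θ : ℝ) : (1 + (Real.exp θ - 1) • T - exp (θ • T)).PosSemidef := by
  obtain ⟨h1, h2⟩ := unitary_mul_conjTranspose hT.1.eigenvectorUnitary
  have key := eq_conj_diagonal_of_isHermitian hT.1
  rw [exp_smul_eq_conj_diagonal hT.1 θ]
  set U := (hT.1.eigenvectorUnitary : Matrix n n ℂ)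
  set l := hT.1.eigenvalues
  have hle (i : n) : l i ≤ 1 := by
    have h := hT1.conjTranspose_mul_mul_same U
    have e : Uᴴ * (1 - T) * U = diagonal (fun i => ((1 - l i : ℝ) : ℂ)) := by
      rw [key, Matrix.mul_sub, Matrix.sub_mul, Matrix.mul_one, h2]
      rw [show Uᴴ * (U * diagonal (fun i => (l i : ℂ)) * Uᴴ) * U
        = (Uᴴ * U) * diagonal (fun i => (l i : ℂ)) * (Uᴴ * U) by simp only [Matrix.mul_assoc], h2,
        Matrix.one_mul, Matrix.mul_one, ← diagonal_one, diagonal_sub]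
      simp
    rw [e, posSemidef_diagonal_iff] at h
    have := Complex.zero_le_real.1 (h i)
    linarith
  have e : 1 + (Real.exp θ - 1) • T
      - U * diagonal (fun i => (Real.exp (θ * l i) : ℂ)) * Uᴴ
      = U * diagonal (fun i => ((1 + (Real.exp θ - 1) * l i - Real.exp (θ * l i) : ℝ) : ℂ)) * Uᴴ := by
    have : diagonal (fun i => ((1 + (Real.exp θ - 1) * l i - Real.exp (θ * l i) : ℝ) : ℂ))
        = 1 + (Real.exp θ - 1) • diagonal (fun i => (l i : ℂ))
          - diagonal (fun i => (Real.exp (θ * l i) : ℂ)) := by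
      rw [← diagonal_one, ← diagonal_smul, diagonal_add, diagonal_sub]
      congr 1; ext i; simp
    rw [this, Matrix.mul_sub, Matrix.mul_add, Matrix.sub_mul, Matrix.add_mul, Matrix.mul_one, h1,
      Matrix.mul_smul, Matrix.smul_mul, ← key]
  rw [e]
  refine PosSemidef.mul_mul_conjTranspose_same (PosSemidef.diagonal fun i => ?_) _
  refine Complex.zero_le_real.2 (sub_nonneg.2 ?_)
  have hc := convexOn_exp.2 (Set.mem_univ 0) (Set.mem_univ θ) (sub_nonneg.2 (hle i))
    (hT.eigenvalues_nonneg i) (by ring)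
  simp only [smul_eq_mul, mul_zero, zero_add, Real.exp_zero, mul_one] at hc
  rw [mul_comm θ]
  calc _ ≤ 1 - l i + l i * Real.exp θ := hc
    _ = _ := by ring

theorem posSemidef_sub_of_trace_exp_lt {Z : Matrix n n ℂ} (hZ : Z.IsHermitian) {θ L : ℝ}
    (hθ : 0 < θ) (h : (exp (θ • Z)).trace.re < Real.exp (θ * L)) :
    (L • (1 : Matrix n n ℂ) - Z).PosSemidef := by
  obtain ⟨h1, h2⟩ := unitary_mul_conjTranspose hZ.eigenvectorUnitary
  have key := eq_conj_diagonal_of_isHermitian hZ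
  rw [exp_smul_eq_conj_diagonal hZ θ] at h
  set U := (hZ.eigenvectorUnitary : Matrix n n ℂ)
  set l := hZ.eigenvalues
  rw [trace_mul_comm, ← Matrix.mul_assoc, h2, Matrix.one_mul, trace_diagonal,
    ← Complex.ofReal_sum, Complex.ofReal_re] at h
  have hle (i : n) : l i ≤ L := by
    have := (single_le_sum (f := fun i => Real.exp (θ * l i))
      (fun i _ => (Real.exp_pos _).le) (mem_univ i)).trans_lt h
    exact (lt_of_mul_lt_mul_left (Real.exp_lt_exp.1 this) hθ.le).le
  have e : L • (1 : Matrix n n ℂ) - Z = U * diagonal (fun i => ((L - l i : ℝ) : ℂ)) * Uᴴ := by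
    have : diagonal (fun i => ((L - l i : ℝ) : ℂ))
        = L • (1 : Matrix n n ℂ) - diagonal (fun i => (l i : ℂ)) := by
      rw [← diagonal_one, ← diagonal_smul, diagonal_sub]
      congr 1; ext i; simp
    rw [this, Matrix.mul_sub, Matrix.sub_mul, Matrix.mul_smul, Matrix.mul_one, Matrix.smul_mul, h1,
      ← key]
  rw [e]
  exact PosSemidef.mul_mul_conjTranspose_same
    (PosSemidef.diagonal fun i => Complex.zero_le_real.2 (sub_nonneg.2 (hle i))) _

variable {X : Type*} [Fintype X] {p : X → ℝ} {T : X → Matrix n n ℂ} {c : ℝ}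

/-- One step of the matrix Laplace transform method: adding an independent random effect whose mean
is the scalar `c` inflates the exponential trace by the factor `1 + (exp θ - 1) c` at most. -/
theorem sum_trace_exp_add_le (hp : ∀ x, 0 ≤ p x) (hp1 : ∑ x, p x = 1)
    (hT : ∀ x, (T x).PosSemidef) (hT1 : ∀ x, (1 - T x).PosSemidef)
    (hmean : ∑ x, p x • T x = c • (1 : Matrix n n ℂ)) (θ : ℝ) {H : Matrix n n ℂ}
    (hH : H.IsHermitian) :
    ∑ x, p x * (exp (H + θ • T x)).trace.re ≤ (1 + (Real.exp θ - 1) * c) * (exp H).trace.re := by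
  have hstep (x : X) : (exp (H + θ • T x)).trace.re
      ≤ (exp H).trace.re + (Real.exp θ - 1) * (exp H * T x).trace.re := by
    have hθ : (θ • T x).IsHermitian := by
      rw [Matrix.IsHermitian, conjTranspose_smul, (hT x).1.eq]; simp
    refine (re_trace_exp_add_le hH hθ).trans ?_
    refine (re_trace_mul_le (posSemidef_exp hH)
      (posSemidef_chord_sub_exp (hT x) (hT1 x) θ)).trans_eq ?_
    rw [Matrix.mul_add, trace_add, Matrix.mul_smul, trace_smul, Matrix.mul_one, Complex.add_re,
      Complex.smul_re, smul_eq_mul]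
  have hmean' : ∑ x, p x * (exp H * T x).trace.re = c * (exp H).trace.re := by
    have := congrArg (fun Z => (exp H * Z).trace.re) hmean
    simpa [Matrix.mul_sum, trace_sum] using this
  calc _ ≤ ∑ x, p x * ((exp H).trace.re + (Real.exp θ - 1) * (exp H * T x).trace.re) :=
        sum_le_sum fun x _ => mul_le_mul_of_nonneg_left (hstep x) (hp x)
    _ = (∑ x, p x) * (exp H).trace.re
        + (Real.exp θ - 1) * ∑ x, p x * (exp H * T x).trace.re := by
        rw [sum_mul, mul_sum, ← sum_add_distrib]
        exact sum_congr rfl fun x _ => by ring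
    _ = _ := by rw [hp1, hmean']; ring

/-- Derandomized matrix Chernoff bound. Samples are chosen one at a time, each choice keeping the
score minus the penalty `C * Tr exp` at least as large as its conditional expectation. -/
theorem exists_samples (hp : ∀ x, 0 ≤ p x) (hp1 : ∑ x, p x = 1)
    (hT : ∀ x, (T x).PosSemidef) (hT1 : ∀ x, (1 - T x).PosSemidef)
    (hmean : ∑ x, p x • T x = c • (1 : Matrix n n ℂ)) {θ : ℝ} (hθ : 0 ≤ θ) (hc : 0 ≤ c)
    (s : X → ℝ) {C : ℝ} (hC : 0 ≤ C) (k : ℕ) {H : Matrix n n ℂ} (hH : H.IsHermitian) :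
    ∃ x : Fin k → X, k * ∑ y, p y * s y - C * ((1 + (Real.exp θ - 1) * c) ^ k * (exp H).trace.re)
      ≤ ∑ i, s (x i) - C * (exp (H + θ • ∑ i, T (x i))).trace.re := by
  induction k generalizing H with
  | zero => exact ⟨Fin.elim0, by simp⟩
  | succ k ih =>
    set κ := 1 + (Real.exp θ - 1) * c with hκ
    have hκ0 : 0 ≤ κ := by
      have := Real.one_le_exp hθ
      have : 0 ≤ (Real.exp θ - 1) * c := mul_nonneg (by linarith) hc
      linarith
    set S := ∑ y, p y * s y
    have hch : ∃ y, S - C * κ ^ (k + 1) * (exp H).trace.re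
        ≤ s y - C * κ ^ k * (exp (H + θ • T y)).trace.re := by
      by_contra! hcon
      have h1 : ∑ y, p y * (s y - C * κ ^ k * (exp (H + θ • T y)).trace.re)
          < ∑ y, p y * (S - C * κ ^ (k + 1) * (exp H).trace.re) := by
        obtain ⟨y, hy⟩ : ∃ y, 0 < p y := by
          by_contra! h
          have : ∑ x, p x ≤ 0 := sum_nonpos fun x _ => h x
          linarith
        exact sum_lt_sum (fun y _ => mul_le_mul_of_nonneg_left (hcon y).le (hp y))
          ⟨y, mem_univ y, mul_lt_mul_of_pos_left (hcon y) hy⟩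
      rw [← sum_mul, hp1, one_mul] at h1
      have h2 := mul_le_mul_of_nonneg_left (sum_trace_exp_add_le hp hp1 hT hT1 hmean θ hH)
        (mul_nonneg hC (pow_nonneg hκ0 k))
      have h3 : ∑ y, p y * (s y - C * κ ^ k * (exp (H + θ • T y)).trace.re)
          = S - C * κ ^ k * ∑ y, p y * (exp (H + θ • T y)).trace.re := by
        rw [mul_sum, ← sum_sub_distrib]
        exact sum_congr rfl fun y _ => by ring
      rw [h3, pow_succ] at h1
      linarith
    obtain ⟨y, hy⟩ := hch
    have hH' : (H + θ • T y).IsHermitian := by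
      refine hH.add ?_
      rw [Matrix.IsHermitian, conjTranspose_smul, (hT y).1.eq]; simp
    obtain ⟨x, hx⟩ := ih hH'
    refine ⟨Fin.cons y x, ?_⟩
    simp only [Fin.sum_univ_succ, Fin.cons_zero, Fin.cons_succ, smul_add, ← add_assoc]
    push_cast
    linarith

end Chernoff

/-! ### Channels from Choi states -/

section Channels

open Matrix

variable {A B E F : Type*} [Fintype A] [Fintype B] [Fintype E]

omit [Fintype A] [Fintype B] [Fintype E] in
theorem tensorId_submatrix (N : Matrix A A ℂ →ₗ[ℂ] Matrix B B ℂ) (e : F → E)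
    (X : Matrix (A × E) (A × E) ℂ) :
    tensorId F N (X.submatrix (Prod.map id e) (Prod.map id e)) =
      (tensorId E N X).submatrix (Prod.map id e) (Prod.map id e) := rfl

theorem IsChannel.posSemidef_tensorId {N : Matrix A A ℂ →ₗ[ℂ] Matrix B B ℂ} (hN : IsChannel N)
    {X : Matrix (A × E) (A × E) ℂ} (hX : X.PosSemidef) : (tensorId E N X).PosSemidef := by
  let e := (Fintype.equivFin E).symm
  have h := hN.completelyPositive _ _ (hX.submatrix (Prod.map id e))
  rw [tensorId_submatrix] at h
  exact (posSemidef_submatrix_equiv ((Equiv.refl B).prodCongr e)).1 h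

theorem IsChannel.trace_tensorId {N : Matrix A A ℂ →ₗ[ℂ] Matrix B B ℂ} (hN : IsChannel N)
    (X : Matrix (A × E) (A × E) ℂ) : (tensorId E N X).trace = X.trace := by
  have h (e : E) := hN.tracePreserving (Matrix.of fun a a' => X (a, e) (a', e))
  simp only [trace, diag_apply, of_apply] at h
  simp only [trace, diag_apply, tensorId, of_apply, Fintype.sum_prod_type_right]
  exact Finset.sum_congr rfl fun e _ => h e

omit [Fintype A] [Fintype B] in
theorem posSemidef_sum_blocks {Y : Type*} [Fintype Y] {P : Matrix (Y × E) (Y × E) ℂ}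
    (hP : P.PosSemidef) :
    (Matrix.of fun y y' => ∑ e, ∑ e', P (y, e) (y', e')).PosSemidef := by
  classical
  let S : Matrix (Y × E) Y ℂ := Matrix.of fun p y => if p.1 = y then 1 else 0
  convert hP.conjTranspose_mul_mul_same S using 1
  ext y y'
  simp only [Matrix.mul_apply, of_apply, conjTranspose_apply, S, Fintype.sum_prod_type]
  simp only [apply_ite star, star_one, star_zero, mul_ite, mul_one, mul_zero, ite_mul, one_mul,
    zero_mul, Finset.sum_ite_irrel, Finset.sum_const_zero, Finset.sum_ite_eq', Finset.mem_univ,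
    if_true]
  rw [Finset.sum_comm]

/-- The linear map `E → A` whose Choi operator, normalized to a state, is `τ`. -/
noncomputable def channelOfChoi (τ : Matrix (A × E) (A × E) ℂ) :
    Matrix E E ℂ →ₗ[ℂ] Matrix A A ℂ where
  toFun X := Matrix.of fun a a' => (Fintype.card E : ℂ) * ∑ e, ∑ e', X e e' * τ (a, e) (a', e')
  map_add' X Y := by
    ext a a'
    simp [add_mul, Finset.sum_add_distrib, mul_add]
  map_smul' c X := by
    ext a a'
    simp only [Matrix.smul_apply, smul_eq_mul, of_apply, RingHom.id_apply, mul_assoc, ← Finset.mul_sum]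
    ring

theorem isChannel_channelOfChoi [DecidableEq E] [Nonempty E] {τ : Matrix (A × E) (A × E) ℂ}
    (hτ : τ.PosSemidef)
    (hm : traceOutLeft τ = (1 / (Fintype.card E : ℂ)) • (1 : Matrix E E ℂ)) :
    IsChannel (channelOfChoi τ) where
  completelyPositive k X hX := by
    have h := (hX.kronecker hτ).submatrix
      (fun q : (A × Fin k) × E => ((q.2, q.1.2), (q.1.1, q.2)))
    exact (posSemidef_sum_blocks h).smul (Nat.cast_nonneg (α := ℂ) (Fintype.card E))
  tracePreserving X := by
    have hm' (e e' : E) : ∑ a, τ (a, e) (a, e') = if e = e' then 1 / (Fintype.card E : ℂ) else 0 := by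
      have := congrFun (congrFun hm e) e'
      simpa [traceOutLeft, Matrix.one_apply] using this
    have h : ∑ a, ∑ e, ∑ e', X e e' * τ (a, e) (a, e')
        = ∑ e, ∑ e', X e e' * ∑ a, τ (a, e) (a, e') := by
      simp only [Finset.mul_sum]
      rw [Finset.sum_comm]
      exact Finset.sum_congr rfl fun e _ => Finset.sum_comm
    have hc : (Fintype.card E : ℂ) ≠ 0 := Nat.cast_ne_zero.2 Fintype.card_ne_zero
    simp only [trace, diag_apply, channelOfChoi, LinearMap.coe_mk, AddHom.coe_mk, of_apply,
      ← Finset.mul_sum]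
    rw [h]
    simp only [hm', mul_ite, mul_zero, Finset.sum_ite_eq, Finset.mem_univ, if_true,
      ← Finset.sum_mul]
    field_simp

/-- The maximally entangled state of `E ⊗ E`. -/
noncomputable def maxEntangled (E : Type*) [Fintype E] [DecidableEq E] :
    EuclideanSpace ℂ (E × E) :=
  WithLp.toLp 2 fun q => if q.1 = q.2 then (((Real.sqrt (Fintype.card E))⁻¹ : ℝ) : ℂ) else 0

theorem norm_maxEntangled [DecidableEq E] [Nonempty E] : ‖maxEntangled E‖ = 1 := by
  have hc : (0 : ℝ) < Fintype.card E := Nat.cast_pos.2 Fintype.card_pos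
  rw [EuclideanSpace.norm_eq, Real.sqrt_eq_one, Fintype.sum_prod_type]
  simp only [maxEntangled, apply_ite norm, norm_zero, ite_pow, ne_eq, OfNat.ofNat_ne_zero,
    not_false_eq_true, zero_pow, Finset.sum_ite_eq, Finset.mem_univ, if_true, Finset.sum_const,
    Finset.card_univ, nsmul_eq_mul, Complex.norm_real, Real.norm_eq_abs, sq_abs, inv_pow,
    Real.sq_sqrt hc.le]
  exact mul_inv_cancel₀ hc.ne'

omit [Fintype A] in
/-- Steering: one half of the maximally entangled state is turned into any prescribed state with
maximally mixed marginal by acting on the other half alone. -/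
theorem tensorId_channelOfChoi_maxEntangled [DecidableEq E] [Nonempty E]
    (τ : Matrix (A × E) (A × E) ℂ) :
    tensorId E (channelOfChoi τ) (ketbra (maxEntangled E)) = τ := by
  have hc : (0 : ℝ) < Fintype.card E := Nat.cast_pos.2 Fintype.card_pos
  have hs : (((Real.sqrt (Fintype.card E))⁻¹ : ℝ) : ℂ) * (((Real.sqrt (Fintype.card E))⁻¹ : ℝ) : ℂ)
      = (Fintype.card E : ℂ)⁻¹ := by
    rw [← Complex.ofReal_mul, ← mul_inv, Real.mul_self_sqrt hc.le]; simp
  ext ⟨a, f⟩ ⟨a', f'⟩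
  simp only [tensorId, channelOfChoi, ketbra, maxEntangled, LinearMap.coe_mk, AddHom.coe_mk,
    of_apply, apply_ite star, star_zero, ite_mul, mul_ite, mul_zero, zero_mul,
    Finset.sum_ite_eq', Finset.mem_univ, if_true]
  rw [Complex.star_def, Complex.conj_ofReal, hs, ← mul_assoc,
    mul_inv_cancel₀ (by exact_mod_cast hc.ne'), one_mul]

end Channels

/-! ### Codes from Choi states -/

section Codes

open Matrix

theorem trace_submatrix_equiv {m n : Type*} [Fintype m] [Fintype n] (e : m ≃ n)
    (X : Matrix n n ℂ) : (X.submatrix e e).trace = X.trace := by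
  simp only [trace, diag_apply, submatrix_apply]
  exact e.sum_comp fun i => X i i

variable {A B E : Type*} [Fintype A] [Fintype B] [DecidableEq B] [Fintype E] {M : ℕ}

theorem exists_code_of_choi_states [DecidableEq E] [Nonempty E]
    {τ : Fin M → Matrix (A × E) (A × E) ℂ}
    (hτ : ∀ m, (τ m).PosSemidef)
    (hm : ∀ m, traceOutLeft (τ m) = (1 / (Fintype.card E : ℂ)) • (1 : Matrix E E ℂ))
    {D : Fin M → Matrix (B × E) (B × E) ℂ} (hD : ∀ m, (D m).PosSemidef) (hD1 : ∑ m, D m = 1)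
    (N : Matrix A A ℂ →ₗ[ℂ] Matrix B B ℂ) :
    ∃ C : EACode A B M, ∀ m, C.successProbOf N m = (D m * tensorId E N (τ m)).trace.re := by
  let e := (Fintype.equivFin E).symm
  let fA : A × Fin (Fintype.card E) → A × E := Prod.map id e
  let fB : B × Fin (Fintype.card E) ≃ B × E := (Equiv.refl B).prodCongr e
  have : NeZero (Fintype.card E) := ⟨Fintype.card_ne_zero⟩
  have hm' (m : Fin M) : traceOutLeft ((τ m).submatrix fA fA)
      = (1 / (Fintype.card (Fin (Fintype.card E)) : ℂ)) • 1 := by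
    have h := congrArg (fun Z => Z.submatrix e e) (hm m)
    simp only [submatrix_smul, submatrix_one_equiv, Pi.smul_apply] at h
    rw [Fintype.card_fin]
    exact h
  refine ⟨{ dimEA := Fintype.card E
            dimEB := Fintype.card E
            Ψ := maxEntangled _
            norm_Ψ := norm_maxEntangled
            enc := fun m => channelOfChoi ((τ m).submatrix fA fA)
            enc_isChannel := fun m => isChannel_channelOfChoi ((hτ m).submatrix _) (hm' m)
            dec := fun m => (D m).submatrix fB fB
            dec_posSemidef := fun m => (hD m).submatrix _
            dec_sum := ?_ }, fun m => ?_⟩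
  · have h := congrArg (fun Z => Z.submatrix fB fB) hD1
    simp only [submatrix_one_equiv] at h
    rw [← h]
    ext p q
    simp [Matrix.sum_apply]
  · simp only [EACode.successProbOf]
    rw [tensorId_channelOfChoi_maxEntangled]
    have : tensorId (Fin (Fintype.card E)) N ((τ m).submatrix fA fA)
        = (tensorId E N (τ m)).submatrix fB fB := rfl
    rw [this, submatrix_mul_equiv, trace_submatrix_equiv]

omit [Fintype A] [Fintype B] [DecidableEq B] in
theorem posSemidef_ketbra (ψ : EuclideanSpace ℂ E) : (ketbra ψ).PosSemidef :=
  posSemidef_vecMulVec_self_star ψ.ofLp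

omit [Fintype A] [Fintype B] [DecidableEq B] in
theorem trace_ketbra (ψ : EuclideanSpace ℂ E) : (ketbra ψ).trace = ((‖ψ‖ ^ 2 : ℝ) : ℂ) := by
  rw [EuclideanSpace.norm_sq_eq]
  simp [trace, ketbra, Complex.mul_conj, Complex.normSq_eq_norm_sq]

theorem EACode.successProb_le_one (C : EACode A B M) {N : Matrix A A ℂ →ₗ[ℂ] Matrix B B ℂ}
    (hN : IsChannel N) : C.successProb N ≤ 1 := by
  have h (m : Fin M) : C.successProbOf N m ≤ 1 := by
    have hσ := hN.posSemidef_tensorId ((C.enc_isChannel m).posSemidef_tensorId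
      (posSemidef_ketbra C.Ψ))
    have hle : (1 - C.dec m).PosSemidef := by
      rw [← C.dec_sum, ← Finset.add_sum_erase _ _ (Finset.mem_univ m), add_sub_cancel_left]
      exact posSemidef_sum _ fun i _ => C.dec_posSemidef i
    have := re_trace_mul_le hσ hle
    rw [Matrix.mul_one, hN.trace_tensorId, (C.enc_isChannel m).trace_tensorId, trace_ketbra,
      C.norm_Ψ, trace_mul_comm] at this
    simpa [EACode.successProbOf] using this
  rw [EACode.successProb]
  calc _ ≤ (1 / (M : ℝ)) * ∑ _m : Fin M, (1 : ℝ) := by gcongr with m; exact h m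
    _ ≤ 1 := by
      rw [Finset.sum_const, Finset.card_univ, Fintype.card_fin, nsmul_eq_mul, mul_one, one_div]
      exact inv_mul_le_one

theorem bddAbove_successProb {N : Matrix A A ℂ →ₗ[ℂ] Matrix B B ℂ} (hN : IsChannel N) :
    BddAbove (Set.range fun C : EACode A B M => C.successProb N) :=
  ⟨1, by rintro _ ⟨C, rfl⟩; exact C.successProb_le_one hN⟩

end Codes

/-! ### Random coding -/

section Ensembles

open Matrix NormedSpace

variable {A B E X : Type*} [Fintype A] [Fintype B] [DecidableEq B] [Fintype E] [DecidableEq E]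
  [Fintype X]

omit [Fintype B] [DecidableEq B] in
theorem trace_eq_one_of_marginal [Nonempty E] {τ : Matrix (A × E) (A × E) ℂ}
    (hm : traceOutLeft τ = (1 / (Fintype.card E : ℂ)) • (1 : Matrix E E ℂ)) : τ.trace = 1 := by
  have h : τ.trace = (traceOutLeft τ).trace := by
    simp [trace, traceOutLeft, Fintype.sum_prod_type_right]
  have hc : (Fintype.card E : ℂ) ≠ 0 := Nat.cast_ne_zero.2 Fintype.card_ne_zero
  rw [h, hm, trace_smul, trace_one, smul_eq_mul]
  field_simp

/-- From a random Choi state `τ x` and effect `T x` to a code. If the mean effect is `1 / M`, the sum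
of `M` independent effects stays below `L` with high probability, so the effects rescaled by `1 / L`
can be completed to a POVM. The hypothesis `hd` says that the failure probability is at most half
the expected score `S`. -/
theorem le_sucEA_of_ensemble [Nonempty E] {N : Matrix A A ℂ →ₗ[ℂ] Matrix B B ℂ}
    (hN : IsChannel N) {M : ℕ} (hM : 1 ≤ M) {p : X → ℝ} (hp : ∀ x, 0 ≤ p x) (hp1 : ∑ x, p x = 1)
    {τ : X → Matrix (A × E) (A × E) ℂ} (hτ : ∀ x, (τ x).PosSemidef)
    (hm : ∀ x, traceOutLeft (τ x) = (1 / (Fintype.card E : ℂ)) • (1 : Matrix E E ℂ))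
    {T : X → Matrix (B × E) (B × E) ℂ} (hT : ∀ x, (T x).PosSemidef)
    (hT1 : ∀ x, (1 - T x).PosSemidef)
    (hmean : ∑ x, p x • T x = (1 / (M : ℝ)) • (1 : Matrix (B × E) (B × E) ℂ))
    {S : ℝ} (hS : S = ∑ x, p x * (T x * tensorId E N (τ x)).trace.re) (hS0 : 0 < S)
    {L : ℝ} (hL : Real.exp 2 ≤ L)
    (hd : 2 * (Fintype.card B * Fintype.card E * Real.exp (-L - 1)) ≤ S) :
    S / (2 * L) ≤ sucEA N M := by
  have hM0 : (0 : ℝ) < M := by exact_mod_cast hM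
  have hL0 : 0 < L := (Real.exp_pos 2).trans_le hL
  set s : X → ℝ := fun x => (T x * tensorId E N (τ x)).trace.re with hs
  have hσ (x : X) := hN.posSemidef_tensorId (hτ x)
  have hs1 (x : X) : s x ≤ 1 := by
    have := re_trace_mul_le (hσ x) (hT1 x)
    rw [Matrix.mul_one, hN.trace_tensorId, trace_eq_one_of_marginal (hm x),
      trace_mul_comm] at this
    simpa [hs] using this
  set C : ℝ := M * Real.exp (-(2 * L)) with hC
  have hC0 : 0 < C := by positivity
  obtain ⟨x, hx⟩ := exists_samples hp hp1 hT hT1 hmean (θ := 2) (by norm_num) (by positivity) s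
    hC0.le M (H := 0) isHermitian_zero
  rw [← hS, exp_zero, trace_one, zero_add, Complex.natCast_re, Fintype.card_prod,
    Nat.cast_mul] at hx
  -- `L ≥ exp 2` absorbs the growth `exp (exp 2 - 1)` of the penalty over the `M` rounds.
  have hpen : C * ((1 + (Real.exp 2 - 1) * (1 / (M : ℝ))) ^ M *
      (Fintype.card B * Fintype.card E)) ≤ M * S / 2 := by
    have h1 : (1 + (Real.exp 2 - 1) * (1 / (M : ℝ))) ^ M ≤ Real.exp (Real.exp 2 - 1) := by
      have h0 : 0 ≤ 1 + (Real.exp 2 - 1) * (1 / (M : ℝ)) := by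
        have := Real.one_le_exp (x := 2) (by norm_num)
        have : 0 ≤ (Real.exp 2 - 1) * (1 / (M : ℝ)) := mul_nonneg (by linarith) (by positivity)
        linarith
      have h2 := Real.add_one_le_exp ((Real.exp 2 - 1) * (1 / (M : ℝ)))
      calc _ ≤ (Real.exp ((Real.exp 2 - 1) * (1 / (M : ℝ)))) ^ M :=
            pow_le_pow_left₀ h0 (by linarith) M
        _ = _ := by rw [← Real.exp_nat_mul]; congr 1; field_simp
    have h3 : Real.exp (-(2 * L)) * Real.exp (Real.exp 2 - 1) ≤ Real.exp (-L - 1) := by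
      rw [← Real.exp_add]; exact Real.exp_le_exp.2 (by linarith)
    calc _ ≤ C * (Real.exp (Real.exp 2 - 1) * (Fintype.card B * Fintype.card E)) := by gcongr
      _ = M * (Fintype.card B * Fintype.card E) *
          (Real.exp (-(2 * L)) * Real.exp (Real.exp 2 - 1)) := by rw [hC]; ring
      _ ≤ M * (Fintype.card B * Fintype.card E) * Real.exp (-L - 1) := by gcongr
      _ ≤ _ := by nlinarith
  set Z := ∑ i, T (x i) with hZ
  have hZp : Z.PosSemidef := posSemidef_sum _ fun i _ => hT (x i)
  have hexp0 : 0 ≤ (exp ((2 : ℝ) • Z)).trace.re :=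
    (Complex.le_def.1 (posSemidef_exp
      (posSemidef_real_smul hZp zero_le_two).1).trace_nonneg).1
  have hMS : 0 < M * S := by positivity
  have hsum1 : ∑ i, s (x i) ≤ M := by
    calc _ ≤ ∑ _i : Fin M, (1 : ℝ) := Finset.sum_le_sum fun i _ => hs1 _
      _ = M := by simp
  have hsum2 : M * S / 2 ≤ ∑ i, s (x i) := by
    have := mul_nonneg hC0.le hexp0
    linarith
  have hle : (L • (1 : Matrix (B × E) (B × E) ℂ) - Z).PosSemidef := by
    refine posSemidef_sub_of_trace_exp_lt hZp.1 (θ := 2) zero_lt_two ?_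
    have h1 : C * (exp ((2 : ℝ) • Z)).trace.re < M := by linarith
    rw [hC, mul_assoc] at h1
    have h2 : Real.exp (-(2 * L)) * (exp ((2 : ℝ) • Z)).trace.re < 1 := by
      by_contra! h
      nlinarith
    rw [Real.exp_neg, inv_mul_lt_iff₀ (Real.exp_pos _), mul_one] at h2
    exact h2
  have hrem : (1 - L⁻¹ • Z).PosSemidef := by
    have := posSemidef_real_smul hle (inv_nonneg.2 hL0.le)
    rwa [smul_sub, smul_smul, inv_mul_cancel₀ hL0.ne', one_smul] at this
  -- The part of the identity left over by the rescaled effects is assigned to one message.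
  have : NeZero M := ⟨by omega⟩
  let D : Fin M → Matrix (B × E) (B × E) ℂ := fun i =>
    L⁻¹ • T (x i) + if i = 0 then 1 - L⁻¹ • Z else 0
  have hD (i : Fin M) : (D i).PosSemidef := by
    refine (posSemidef_real_smul (hT _) (inv_nonneg.2 hL0.le)).add ?_
    split_ifs
    · exact hrem
    · exact PosSemidef.zero
  have hD1 : ∑ i, D i = 1 := by
    simp only [D, Finset.sum_add_distrib, Finset.sum_ite_eq', Finset.mem_univ, if_true,
      ← Finset.smul_sum, ← hZ, add_sub_cancel]
  obtain ⟨code, hcode⟩ := exists_code_of_choi_states (fun i => hτ (x i)) (fun i => hm (x i))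
    hD hD1 N
  have hprob (i : Fin M) : L⁻¹ * s (x i) ≤ code.successProbOf N i := by
    rw [hcode, trace_mul_comm]
    have h : (D i - L⁻¹ • T (x i)).PosSemidef := by
      simp only [D, add_sub_cancel_left]
      split_ifs
      · exact hrem
      · exact PosSemidef.zero
    refine le_trans (le_of_eq ?_) (re_trace_mul_le (hσ (x i)) h)
    rw [Matrix.mul_smul, trace_smul, Complex.smul_re, smul_eq_mul, trace_mul_comm]
  refine le_trans ?_ (le_csSup (bddAbove_successProb hN) ⟨code, rfl⟩)
  simp only [EACode.successProb]
  calc S / (2 * L) = (1 / (M : ℝ)) * (L⁻¹ * (M * S / 2)) := by field_simp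
    _ ≤ (1 / (M : ℝ)) * (L⁻¹ * ∑ i, s (x i)) := by gcongr
    _ ≤ _ := by
      rw [Finset.mul_sum]
      gcongr with i
      exact hprob i

end Ensembles

/-! ### Twirling by Pauli operators -/

section Twirl

open Matrix

/-- The generalized Pauli operators: the shift by `α` after the diagonal phase of frequency `β`. -/
noncomputable def pauli (r : ℕ) [NeZero r] (p : ZMod r × ZMod r) : Matrix (ZMod r) (ZMod r) ℂ :=
  Matrix.of fun k l => if k = l + p.1 then ZMod.stdAddChar (p.2 * l) else 0

theorem pauli_mul_conjTranspose (r : ℕ) [NeZero r] (p : ZMod r × ZMod r) :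
    pauli r p * (pauli r p)ᴴ = 1 := by
  ext k k'
  have hχ (y : ZMod r) : ZMod.stdAddChar y * star (ZMod.stdAddChar y : ℂ) = 1 := by
    rw [Complex.star_def, Complex.mul_conj, Complex.normSq_eq_norm_sq, AddChar.norm_apply]; simp
  simp only [Matrix.mul_apply, conjTranspose_apply, pauli, of_apply, Matrix.one_apply]
  rw [Finset.sum_eq_single (k - p.1)]
  · by_cases h : k = k'
    · subst h
      simpa using hχ (p.2 * (k - p.1))
    · simp [h, Ne.symm h]
  · intro l _ hl
    rw [if_neg (fun h => hl (by rw [h]; ring)), zero_mul]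
  · simp

theorem sum_pauli_mul_pauli (r : ℕ) [NeZero r] (k l k' l' : ZMod r) :
    ∑ p, star (pauli r p k l) * pauli r p k' l' = if k = k' ∧ l = l' then (r : ℂ) else 0 := by
  have hχ (β : ZMod r) : star (ZMod.stdAddChar (β * l) : ℂ) * ZMod.stdAddChar (β * l')
      = ZMod.stdAddChar (β * (l' - l)) := by
    rw [Complex.star_def, ← AddChar.map_neg_eq_conj, ← AddChar.map_add_eq_mul]
    congr 1; ring
  have hsum : ∑ β : ZMod r, (ZMod.stdAddChar (β * (l' - l)) : ℂ) = if l = l' then (r : ℂ) else 0 := by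
    rw [AddChar.sum_mulShift _ (ZMod.isPrimitive_stdAddChar r), ZMod.card]
    simp [sub_eq_zero, eq_comm]
  have hα (α : ZMod r) : ∑ β, star (pauli r (α, β) k l) * pauli r (α, β) k' l'
      = if k = l + α ∧ k' = l' + α then (if l = l' then (r : ℂ) else 0) else 0 := by
    by_cases h1 : k = l + α <;> by_cases h2 : k' = l' + α <;> simp [pauli, h1, h2]
    simpa only [← hχ, Complex.star_def] using hsum
  rw [Fintype.sum_prod_type]
  simp only [hα]
  rw [Finset.sum_eq_single (k - l)]
  · by_cases hl : l = l'
    · subst hl; simp [eq_comm]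
    · simp [hl]
  · intro α _ hne
    rw [if_neg fun h => hne (by rw [h.1]; ring)]
  · simp

/-- The Pauli operators, transported to an arbitrary index type: unitaries whose matrix entries
satisfy the Schur orthogonality relations. -/
theorem exists_unitary_design (R : Type*) [Fintype R] [DecidableEq R] [Nonempty R] :
    ∃ U : R × R → Matrix R R ℂ, (∀ p, U p * (U p)ᴴ = 1) ∧
      ∀ k l k' l', ∑ p, star (U p k l) * U p k' l' =
        if k = k' ∧ l = l' then (Fintype.card R : ℂ) else 0 := by
  have : NeZero (Fintype.card R) := ⟨Fintype.card_ne_zero⟩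
  let e : R ≃ ZMod (Fintype.card R) := Fintype.equivOfCardEq (ZMod.card _).symm
  refine ⟨fun p => (pauli _ (e p.1, e p.2)).submatrix e e, fun p => ?_, fun k l k' l' => ?_⟩
  · rw [conjTranspose_submatrix, submatrix_mul_equiv, pauli_mul_conjTranspose,
      submatrix_one_equiv]
  · simp only [submatrix_apply]
    refine ((e.prodCongr e).sum_comp
      (fun p => star (pauli _ p (e k) (e l)) * pauli _ p (e k') (e l'))).trans ?_
    rw [sum_pauli_mul_pauli]
    simp

/-- The marginal on `B` of an operator on `B ⊗ R`. -/
def traceOutRight {B R : Type*} [Fintype R] (X : Matrix (B × R) (B × R) ℂ) : Matrix B B ℂ :=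
  Matrix.of fun b b' => ∑ r : R, X (b, r) (b', r)

/-- Twirling the factor `R` by a unitary design replaces it by the maximally mixed state. -/
theorem sum_conj_design {B R : Type*} [Fintype B] [DecidableEq B] [Fintype R] [DecidableEq R]
    {U : R × R → Matrix R R ℂ}
    (hU : ∀ k l k' l', ∑ p, star (U p k l) * U p k' l' =
        if k = k' ∧ l = l' then (Fintype.card R : ℂ) else 0)
    (K : Matrix (B × R) (B × R) ℂ) :
    ∑ p, ((1 : Matrix B B ℂ) ⊗ₖ U p)ᴴ * K * ((1 : Matrix B B ℂ) ⊗ₖ U p) =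
      (Fintype.card R : ℂ) • (traceOutRight K ⊗ₖ (1 : Matrix R R ℂ)) := by
  ext ⟨b, l⟩ ⟨b', l'⟩
  have h (p : R × R) : (((1 : Matrix B B ℂ) ⊗ₖ U p)ᴴ * K * ((1 : Matrix B B ℂ) ⊗ₖ U p)) (b, l) (b', l')
      = ∑ k', ∑ k, K (b, k) (b', k') * (star (U p k l) * U p k' l') := by
    simp only [Matrix.mul_apply, conjTranspose_apply, kroneckerMap_apply, Fintype.sum_prod_type,
      Matrix.one_apply, ite_mul, one_mul, zero_mul, mul_ite, mul_zero, apply_ite star, star_zero,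
      Finset.sum_ite_irrel, Finset.sum_const_zero, Finset.sum_ite_eq', Finset.mem_univ, if_true,
      Finset.sum_mul]
    exact Finset.sum_congr rfl fun k' _ => Finset.sum_congr rfl fun k _ => by ring
  rw [Matrix.sum_apply]
  simp only [h]
  rw [Finset.sum_comm]
  simp only [Finset.sum_comm (s := (Finset.univ : Finset (R × R))), ← Finset.mul_sum, hU]
  simp only [Matrix.smul_apply, smul_eq_mul, kroneckerMap_apply, traceOutRight, of_apply, Matrix.one_apply]
  by_cases hl : l = l'
  · simp [hl, Finset.mul_sum, mul_comm]
  · simp [hl]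

end Twirl

/-! ### Compressions of bipartite operators -/

section Compression

open Matrix

variable {A B R : Type*} [Fintype A] [Fintype B] [DecidableEq B]

/-- The compression of an operator on `A ⊗ B` along `W : ℂ^R → ℂ^A`, with the two tensor factors
exchanged. -/
def compress (W : Matrix A R ℂ) (K : Matrix (A × B) (A × B) ℂ) : Matrix (B × R) (B × R) ℂ :=
  ((W ⊗ₖ (1 : Matrix B B ℂ))ᴴ * K * (W ⊗ₖ (1 : Matrix B B ℂ))).submatrix Prod.swap Prod.swap

theorem compress_apply (W : Matrix A R ℂ) (K : Matrix (A × B) (A × B) ℂ) (b b' : B) (k k' : R) :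
    compress W K (b, k) (b', k') = ∑ a, ∑ a', star (W a k) * W a' k' * K (a, b) (a', b') := by
  simp only [compress, submatrix_apply, Prod.swap, Matrix.mul_apply, conjTranspose_apply,
    kroneckerMap_apply, Fintype.sum_prod_type, Matrix.one_apply, ite_mul, zero_mul,
    mul_ite, mul_one, mul_zero, apply_ite star, star_zero, Finset.sum_ite_eq', Finset.mem_univ, if_true, Finset.sum_mul]
  rw [Finset.sum_comm]
  exact Finset.sum_congr rfl fun a _ => Finset.sum_congr rfl fun a' _ => by ring

theorem posSemidef_compress [Fintype R] (W : Matrix A R ℂ) {K : Matrix (A × B) (A × B) ℂ}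
    (hK : K.PosSemidef) : (compress W K).PosSemidef :=
  (hK.conjTranspose_mul_mul_same _).submatrix _

theorem compress_sub (W : Matrix A R ℂ) (K K' : Matrix (A × B) (A × B) ℂ) :
    compress W (K - K') = compress W K - compress W K' := by
  simp only [compress, Matrix.mul_sub, Matrix.sub_mul]; rfl

theorem compress_kronecker_one (W : Matrix A R ℂ) (ρ : Matrix A A ℂ) :
    compress W (ρ ⊗ₖ (1 : Matrix B B ℂ)) = (1 : Matrix B B ℂ) ⊗ₖ (Wᴴ * ρ * W) := by
  rw [compress, conjTranspose_kronecker, ← mul_kronecker_mul, ← mul_kronecker_mul,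
    conjTranspose_one, Matrix.one_mul, Matrix.one_mul]
  ext ⟨b, k⟩ ⟨b', k'⟩
  simp [mul_comm]

theorem compress_mul [Fintype R] [DecidableEq R] (Y : Matrix A R ℂ) (U : Matrix R R ℂ)
    (K : Matrix (A × B) (A × B) ℂ) :
    compress (Y * U) K = ((1 : Matrix B B ℂ) ⊗ₖ U)ᴴ * compress Y K * ((1 : Matrix B B ℂ) ⊗ₖ U) := by
  have e : ((1 : Matrix B B ℂ) ⊗ₖ U) = (U ⊗ₖ (1 : Matrix B B ℂ)).submatrix
      (Equiv.prodComm B R) (Equiv.prodComm B R) := by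
    ext ⟨b, k⟩ ⟨b', k'⟩
    simp [mul_comm]
  have e' (Z : Matrix (R × B) (R × B) ℂ) : Z.submatrix Prod.swap Prod.swap
      = Z.submatrix (Equiv.prodComm B R) (Equiv.prodComm B R) := rfl
  have h : (Y * U) ⊗ₖ (1 : Matrix B B ℂ) = (Y ⊗ₖ (1 : Matrix B B ℂ)) * (U ⊗ₖ (1 : Matrix B B ℂ)) := by
    rw [← mul_kronecker_mul, Matrix.one_mul]
  rw [compress, compress, e, h, e', e', conjTranspose_submatrix, submatrix_mul_equiv,
    submatrix_mul_equiv, conjTranspose_mul]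
  simp only [Matrix.mul_assoc]

theorem trace_compress_mul_compress [Fintype R] (W : Matrix A R ℂ) (K K' : Matrix (A × B) (A × B) ℂ) :
    (compress W K * compress W K').trace =
      (K * ((W * Wᴴ) ⊗ₖ (1 : Matrix B B ℂ)) * K' * ((W * Wᴴ) ⊗ₖ (1 : Matrix B B ℂ))).trace := by
  have h : (W * Wᴴ) ⊗ₖ (1 : Matrix B B ℂ)
      = (W ⊗ₖ (1 : Matrix B B ℂ)) * (W ⊗ₖ (1 : Matrix B B ℂ))ᴴ := by
    rw [conjTranspose_kronecker, ← mul_kronecker_mul, conjTranspose_one, Matrix.one_mul]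
  have e' (Z : Matrix (R × B) (R × B) ℂ) : Z.submatrix Prod.swap Prod.swap
      = Z.submatrix (Equiv.prodComm B R) (Equiv.prodComm B R) := rfl
  rw [compress, compress, e', e', submatrix_mul_equiv, trace_submatrix_equiv, h]
  set V := W ⊗ₖ (1 : Matrix B B ℂ)
  rw [show Vᴴ * K * V * (Vᴴ * K' * V) = Vᴴ * (K * (V * Vᴴ) * K' * V) by
    simp only [Matrix.mul_assoc], trace_mul_comm]
  simp only [Matrix.mul_assoc]

end Compression

/-! ### Ampliation to a larger ancilla -/

section Ampliation

open Matrix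

variable {Z A B E R F : Type*} [DecidableEq F]

/-- The ampliation of an operator on `Z ⊗ R` to `Z ⊗ E`, acting as the identity on the second
factor of the tensor decomposition `E = R ⊗ F` given by `ε`. -/
def ampliate (Z : Type*) (ε : E ≃ R × F) :
    Matrix (Z × R) (Z × R) ℂ →ₗ[ℂ] Matrix (Z × E) (Z × E) ℂ where
  toFun Y := Matrix.of fun p q =>
    Y (p.1, (ε p.2).1) (q.1, (ε q.2).1) * (1 : Matrix F F ℂ) (ε p.2).2 (ε q.2).2
  map_add' Y Y' := by ext; simp [add_mul]
  map_smul' c Y := by ext; simp [mul_assoc]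

theorem ampliate_apply (ε : E ≃ R × F) (Y : Matrix (Z × R) (Z × R) ℂ) (z z' : Z) (e e' : E) :
    ampliate Z ε Y (z, e) (z', e') =
      Y (z, (ε e).1) (z', (ε e').1) * (1 : Matrix F F ℂ) (ε e).2 (ε e').2 := rfl

theorem ampliate_eq_submatrix (ε : E ≃ R × F) (Y : Matrix (Z × R) (Z × R) ℂ) :
    ampliate Z ε Y = (Y ⊗ₖ (1 : Matrix F F ℂ)).submatrix
      (((Equiv.refl Z).prodCongr ε).trans (Equiv.prodAssoc Z R F).symm)
      (((Equiv.refl Z).prodCongr ε).trans (Equiv.prodAssoc Z R F).symm) := rfl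

theorem posSemidef_ampliate [Finite F] (ε : E ≃ R × F) {Y : Matrix (Z × R) (Z × R) ℂ}
    [Finite Z] [Finite R] (hY : Y.PosSemidef) : (ampliate Z ε Y).PosSemidef := by
  rw [ampliate_eq_submatrix]
  exact (hY.kronecker PosSemidef.one).submatrix _

theorem one_apply_equiv_prod [DecidableEq E] [DecidableEq R] (ε : E ≃ R × F) (e e' : E) :
    (1 : Matrix R R ℂ) (ε e).1 (ε e').1 * (1 : Matrix F F ℂ) (ε e).2 (ε e').2
      = (1 : Matrix E E ℂ) e e' := by
  have h : ((1 : Matrix R R ℂ) ⊗ₖ (1 : Matrix F F ℂ)).submatrix ε ε = 1 := by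
    rw [one_kronecker_one, submatrix_one_equiv]
  exact congrFun (congrFun h e) e'

theorem ampliate_kronecker_one [DecidableEq E] [DecidableEq R] (ε : E ≃ R × F)
    (Q : Matrix Z Z ℂ) :
    ampliate Z ε (Q ⊗ₖ (1 : Matrix R R ℂ)) = Q ⊗ₖ (1 : Matrix E E ℂ) := by
  ext ⟨z, e⟩ ⟨z', e'⟩
  simp only [ampliate_apply, kroneckerMap_apply, mul_assoc]
  exact congrArg (Q z z' * ·) (one_apply_equiv_prod ε e e')

theorem trace_ampliate_mul_ampliate [Fintype Z] [Fintype E] [Fintype R] [Fintype F]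
    (ε : E ≃ R × F) (Y Y' : Matrix (Z × R) (Z × R) ℂ) :
    (ampliate Z ε Y * ampliate Z ε Y').trace = (Y * Y').trace * Fintype.card F := by
  rw [ampliate_eq_submatrix, ampliate_eq_submatrix, submatrix_mul_equiv, trace_submatrix_equiv,
    ← mul_kronecker_mul, trace_kronecker, Matrix.one_mul, trace_one]

theorem tensorId_smul (N : Matrix A A ℂ →ₗ[ℂ] Matrix B B ℂ) (c : ℂ)
    (X : Matrix (A × R) (A × R) ℂ) : tensorId R N (c • X) = c • tensorId R N X := by
  ext ⟨b, k⟩ ⟨b', k'⟩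
  exact congrFun (congrFun (N.map_smul c (Matrix.of fun a a' => X (a, k) (a', k'))) b) b'

theorem tensorId_ampliate (N : Matrix A A ℂ →ₗ[ℂ] Matrix B B ℂ) (ε : E ≃ R × F)
    (Y : Matrix (A × R) (A × R) ℂ) :
    tensorId E N (ampliate A ε Y) = ampliate B ε (tensorId R N Y) := by
  ext ⟨b, e⟩ ⟨b', e'⟩
  simp only [tensorId, of_apply, ampliate_apply]
  have : (Matrix.of fun a a' => Y (a, (ε e).1) (a', (ε e').1) *
      (1 : Matrix F F ℂ) (ε e).2 (ε e').2)
      = (1 : Matrix F F ℂ) (ε e).2 (ε e').2 •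
        Matrix.of fun a a' => Y (a, (ε e).1) (a', (ε e').1) := by
    ext a a'; simp [mul_comm]
  rw [this, map_smul, Matrix.smul_apply, smul_eq_mul, mul_comm]

theorem traceOutLeft_ampliate [Fintype A] [DecidableEq E] [DecidableEq R] (ε : E ≃ R × F)
    {Y : Matrix (A × R) (A × R) ℂ} {c : ℂ} (hY : traceOutLeft Y = c • (1 : Matrix R R ℂ)) :
    traceOutLeft (ampliate A ε Y) = c • (1 : Matrix E E ℂ) := by
  ext e e'
  have h := congrFun (congrFun hY (ε e).1) (ε e').1
  simp only [traceOutLeft, of_apply, Matrix.smul_apply, smul_eq_mul] at h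
  simp only [traceOutLeft, of_apply, ampliate_apply, ← Finset.sum_mul, h, Matrix.smul_apply,
    smul_eq_mul, mul_assoc, one_apply_equiv_prod]

end Ampliation

/-! ### Steered states and the Choi matrix -/

section SteeredState

open Matrix

variable {A B R : Type*} [Fintype A] [Fintype R]

/-- The state obtained from the maximally entangled state of `R ⊗ R` by applying the entrywise
conjugate of `W` to the first factor. -/
noncomputable def steeredState (W : Matrix A R ℂ) : Matrix (A × R) (A × R) ℂ :=
  (1 / (Fintype.card R : ℂ)) • vecMulVec (fun p => star (W p.1 p.2)) (fun p => W p.1 p.2)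

theorem posSemidef_steeredState (W : Matrix A R ℂ) : (steeredState W).PosSemidef := by
  refine PosSemidef.smul ?_ (by positivity)
  exact posSemidef_vecMulVec_star_self fun p : A × R => W p.1 p.2

theorem traceOutLeft_steeredState [DecidableEq R] {W : Matrix A R ℂ} (hW : Wᴴ * W = 1) :
    traceOutLeft (steeredState W) = (1 / (Fintype.card R : ℂ)) • (1 : Matrix R R ℂ) := by
  rw [← hW]
  ext k k'
  simp [traceOutLeft, steeredState, vecMulVec_apply, Matrix.mul_apply, Finset.mul_sum]

theorem choi_apply [DecidableEq A] (N : Matrix A A ℂ →ₗ[ℂ] Matrix B B ℂ) (a a' : A) (b b' : B) :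
    choi N (a, b) (a', b') = N (Matrix.single a a' 1) b b' := by
  simp only [choi, Matrix.sum_apply, kroneckerMap_apply, Matrix.single_apply, ite_mul, one_mul,
    zero_mul]
  rw [Finset.sum_eq_single a, Finset.sum_eq_single a'] <;> simp +contextual

/-- The conjugate in `steeredState` makes the channel output the compression of the Choi matrix along
`W` itself, as it is for the effects. -/
theorem tensorId_steeredState [Fintype B] [DecidableEq A] [DecidableEq B]
    (N : Matrix A A ℂ →ₗ[ℂ] Matrix B B ℂ) (W : Matrix A R ℂ) :
    tensorId R N (steeredState W) = (1 / (Fintype.card R : ℂ)) • compress W (choi N) := by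
  ext ⟨b, k⟩ ⟨b', k'⟩
  rw [Matrix.smul_apply, compress_apply]
  have h : (Matrix.of fun a a' => steeredState W (a, k) (a', k'))
      = (1 / (Fintype.card R : ℂ)) •
        ∑ a, ∑ a', (star (W a k) * W a' k') • Matrix.single a a' (1 : ℂ) := by
    conv_lhs => rw [Matrix.matrix_eq_sum_single (Matrix.of _)]
    simp only [Finset.smul_sum, smul_single]
    simp [steeredState, vecMulVec_apply]
  simp only [tensorId, of_apply]
  rw [h]
  simp only [map_smul, map_sum, Matrix.smul_apply, Matrix.sum_apply, smul_eq_mul, choi_apply]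

theorem posSemidef_choi [DecidableEq A] [Fintype B] {N : Matrix A A ℂ →ₗ[ℂ] Matrix B B ℂ}
    (hN : IsChannel N) : (choi N).PosSemidef := by
  have h := hN.posSemidef_tensorId (E := A) (X := vecMulVec
    (fun p => if p.1 = p.2 then 1 else 0) (star fun p => if p.1 = p.2 then 1 else 0))
    (posSemidef_vecMulVec_self_star _)
  convert h.submatrix Prod.swap using 1
  ext ⟨a, b⟩ ⟨a', b'⟩
  rw [choi_apply]
  simp only [tensorId, submatrix_apply, Prod.swap, of_apply]
  refine congrArg (fun Z => N Z b b') ?_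
  ext i i'
  by_cases h1 : i = a <;> by_cases h2 : i' = a' <;>
    simp [Matrix.single_apply, vecMulVec_apply, h1, h2, eq_comm]
  grind

end SteeredState

/-! ### The pinching inequality -/

section Pinching

open Matrix

variable {n J : Type*} [Fintype n] [Fintype J]

/-- **Pinching inequality**: with `Q` Hermitian operators summing to the identity,
`∑ j, Q j K Q j - K / |J|` is a sum of the operators `(Q j - Q k) K (Q j - Q k)`, up to scale. -/
theorem re_trace_mul_le_card_mul_sum [DecidableEq n] {Q : J → Matrix n n ℂ}
    (hQ : ∀ j, (Q j).IsHermitian)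
    (hQ1 : ∑ j, Q j = 1) {P K : Matrix n n ℂ} (hP : P.PosSemidef) (hK : K.PosSemidef) :
    (P * K).trace.re ≤ Fintype.card J * ∑ j, (P * Q j * K * Q j).trace.re := by
  have h (j k : J) : 0 ≤ (P * Q j * K * Q j).trace.re + (P * Q k * K * Q k).trace.re
      - (P * Q j * K * Q k).trace.re - (P * Q k * K * Q j).trace.re := by
    have h1 := hK.mul_mul_conjTranspose_same (Q j - Q k)
    rw [conjTranspose_sub, (hQ j).eq, (hQ k).eq] at h1
    have h2 := re_trace_mul_nonneg hP h1
    have e : P * ((Q j - Q k) * K * (Q j - Q k)) = P * Q j * K * Q j + P * Q k * K * Q k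
        - P * Q j * K * Q k - P * Q k * K * Q j := by noncomm_ring
    rw [e] at h2
    simpa using h2
  have hsum := Finset.sum_nonneg fun j (_ : j ∈ Finset.univ) =>
    Finset.sum_nonneg fun k (_ : k ∈ Finset.univ) => h j k
  have htot : ∑ j, ∑ k, (P * Q j * K * Q k).trace.re = (P * K).trace.re := by
    have : P * K = ∑ j, ∑ k, P * Q j * K * Q k := by
      simp only [← Matrix.mul_sum, ← Matrix.sum_mul, hQ1, Matrix.mul_one]
    rw [this]; simp
  have htot' : ∑ j, ∑ k, (P * Q k * K * Q j).trace.re = (P * K).trace.re := by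
    rw [Finset.sum_comm, htot]
  simp only [Finset.sum_add_distrib, Finset.sum_sub_distrib, htot, htot', Finset.sum_const,
    Finset.card_univ, nsmul_eq_mul, ← Finset.mul_sum] at hsum
  linarith

end Pinching

/-! ### Feasible operators on one block -/

section Blocks

open Matrix

variable {A B Q : Type*} [Fintype A] [Fintype B] [DecidableEq B] [Fintype Q] [DecidableEq Q]
  {ρ : Matrix A A ℂ} {M : ℕ} {Λ : Matrix (A × B) (A × B) ℂ}

theorem posSemidef_smul_one_sub_compress {W : Matrix A Q ℂ} {c : ℝ}
    (hc : Wᴴ * ρ * W = c • (1 : Matrix Q Q ℂ)) (hΛ : NSFeasible M ρ Λ) :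
    (c • (1 : Matrix (B × Q) (B × Q) ℂ) - compress W Λ).PosSemidef := by
  have h := posSemidef_compress W hΛ.le
  rwa [compress_sub, compress_kronecker_one, hc, kronecker_smul, one_kronecker_one] at h

/-- If the eigenvalue of a block vanishes, then so does every feasible operator on that block. -/
theorem smul_compress_eq {W : Matrix A Q ℂ} {c : ℝ}
    (hc : Wᴴ * ρ * W = c • (1 : Matrix Q Q ℂ)) (hΛ : NSFeasible M ρ Λ) :
    (c * c⁻¹) • compress W Λ = compress W Λ := by
  rcases eq_or_ne c 0 with h0 | h0
  · have h := posSemidef_smul_one_sub_compress hc hΛ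
    have h' := posSemidef_compress W hΛ.nonneg
    rw [h0, zero_smul, zero_sub] at h
    have ht := h.trace_nonneg
    rw [trace_neg, neg_nonneg] at ht
    rw [(h'.trace_eq_zero_iff).1 (le_antisymm ht h'.trace_nonneg), smul_zero]
  · rw [mul_inv_cancel₀ h0, one_smul]

end Blocks

/-! ### The code of a block resolution -/

section Resolution

open Matrix

variable {A B J : Type*} [Fintype A] [DecidableEq A] [Fintype B] [DecidableEq B] [Fintype J]
  {R : J → Type*} [∀ j, Fintype (R j)] [∀ j, DecidableEq (R j)]
  {Y : ∀ j, Matrix A (R j) ℂ} {ρ : Matrix A A ℂ} {l : J → ℝ} {M : ℕ}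
  {Λ : Matrix (A × B) (A × B) ℂ}

omit [∀ j, DecidableEq (R j)] in
theorem sum_traceOutRight_compress (hY1 : ∑ j, Y j * (Y j)ᴴ = 1)
    (K : Matrix (A × B) (A × B) ℂ) :
    ∑ j, traceOutRight (compress (Y j) K) = traceOutLeft K := by
  ext b b'
  have h (a a' : A) : ∑ j, ∑ k, star (Y j a k) * Y j a' k = if a' = a then 1 else 0 := by
    have := congrFun (congrFun hY1 a') a
    simp only [Matrix.sum_apply, Matrix.mul_apply, conjTranspose_apply, Matrix.one_apply] at this
    rw [← this]
    exact Finset.sum_congr rfl fun j _ => Finset.sum_congr rfl fun k _ => mul_comm _ _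
  have h2 : ∑ j, ∑ k, ∑ a, ∑ a', star (Y j a k) * Y j a' k * K (a, b) (a', b')
      = ∑ a, ∑ a', (∑ j, ∑ k, star (Y j a k) * Y j a' k) * K (a, b) (a', b') := by
    simp only [Finset.sum_mul]
    calc _ = ∑ j, ∑ a, ∑ k, ∑ a', star (Y j a k) * Y j a' k * K (a, b) (a', b') :=
          Finset.sum_congr rfl fun j _ => Finset.sum_comm
      _ = ∑ a, ∑ j, ∑ a', ∑ k, star (Y j a k) * Y j a' k * K (a, b) (a', b') := by
          rw [Finset.sum_comm]
          exact Finset.sum_congr rfl fun a _ => Finset.sum_congr rfl fun j _ => Finset.sum_comm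
      _ = _ := Finset.sum_congr rfl fun a _ => Finset.sum_comm
  simp only [Matrix.sum_apply, traceOutRight, traceOutLeft, of_apply, compress_apply]
  rw [h2]
  simp only [h, ite_mul, one_mul, zero_mul, Finset.sum_ite_eq', Finset.mem_univ, if_true]

/-- The random code built from a resolution of `ρ` into blocks `Y j` with eigenvalues `l j`.
A sample is a block `j`, drawn with probability `l j * |R j|`, and a uniform Pauli operator on it;
the receiver holds one maximally entangled half `R j` for every block, hence `E = ∏ j, R j`. The
block carries the state and the effect, which act trivially on the other halves. -/
theorem le_sucEA_of_resolution [DecidableEq J] [∀ j, Nonempty (R j)]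
    (hY : ∀ j, (Y j)ᴴ * Y j = 1)
    (hY1 : ∑ j, Y j * (Y j)ᴴ = 1) (hl0 : ∀ j, 0 ≤ l j)
    (hl : ∀ j, (Y j)ᴴ * ρ * Y j = l j • (1 : Matrix (R j) (R j) ℂ))
    (hl1 : ∑ j, l j * Fintype.card (R j) = 1)
    {N : Matrix A A ℂ →ₗ[ℂ] Matrix B B ℂ} (hN : IsChannel N) (hM : 1 ≤ M)
    (hΛ : NSFeasible M ρ Λ) {L : ℝ} (hL : Real.exp 2 ≤ L)
    (hS0 : 0 < (Λ * choi N).trace.re)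
    (hd : 2 * (Fintype.card J *
      (Fintype.card B * (∏ j, Fintype.card (R j) : ℕ) * Real.exp (-L - 1))) ≤
        (Λ * choi N).trace.re) :
    (Λ * choi N).trace.re / (2 * Fintype.card J * L) ≤ sucEA N M := by
  have hL0 : 0 < L := (Real.exp_pos 2).trans_le hL
  let E := ∀ j, R j
  choose U hU hU2 using fun j => exists_unitary_design (R j)
  have hU' (j : J) (p) : (U j p)ᴴ * U j p = 1 := mul_eq_one_comm.1 (hU j p)
  let F (j : J) := ∀ i : {i // i ≠ j}, R i
  let ε (j : J) : E ≃ R j × F j := Equiv.piSplitAt j R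
  have hcard (j : J) : (Fintype.card E : ℂ) = Fintype.card (R j) * Fintype.card (F j) := by
    rw [Fintype.card_congr (ε j), Fintype.card_prod, Nat.cast_mul]
  have hR (j : J) : (Fintype.card (R j) : ℝ) ≠ 0 := Nat.cast_ne_zero.2 Fintype.card_ne_zero
  have hF (j : J) : (Fintype.card (F j) : ℝ) ≠ 0 := Nat.cast_ne_zero.2 Fintype.card_ne_zero
  let S : ℝ := ∑ j, (compress (Y j) Λ * compress (Y j) (choi N)).trace.re
  have hpinch : (Λ * choi N).trace.re ≤ Fintype.card J * S := by
    have h := re_trace_mul_le_card_mul_sum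
      (Q := fun j => (Y j * (Y j)ᴴ) ⊗ₖ (1 : Matrix B B ℂ))
      (fun j => by
        rw [Matrix.IsHermitian, conjTranspose_kronecker, conjTranspose_one,
          (isHermitian_mul_conjTranspose_self (Y j)).eq])
      (by
        rw [← one_kronecker_one, ← hY1]
        ext p q
        simp [Matrix.sum_apply, Finset.sum_mul])
      hΛ.nonneg (posSemidef_choi hN)
    simpa only [S, trace_compress_mul_compress] using h
  have hJ : (0 : ℝ) < Fintype.card J := by
    rcases (Nat.cast_nonneg (α := ℝ) (Fintype.card J)).lt_or_eq with h | h
    · exact h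
    · rw [← h, zero_mul] at hpinch; linarith
  let W (x : Σ j, R j × R j) : Matrix A (R x.1) ℂ := Y x.1 * U x.1 x.2
  have hW (x) : (W x)ᴴ * W x = 1 := by
    simp only [W, conjTranspose_mul]
    rw [show (U x.1 x.2)ᴴ * (Y x.1)ᴴ * (Y x.1 * U x.1 x.2)
      = (U x.1 x.2)ᴴ * ((Y x.1)ᴴ * Y x.1) * U x.1 x.2 by simp only [Matrix.mul_assoc], hY,
      Matrix.mul_one, hU']
  have hWW (x) : W x * (W x)ᴴ = Y x.1 * (Y x.1)ᴴ := by
    simp only [W, conjTranspose_mul]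
    rw [show Y x.1 * U x.1 x.2 * ((U x.1 x.2)ᴴ * (Y x.1)ᴴ)
      = Y x.1 * (U x.1 x.2 * (U x.1 x.2)ᴴ) * (Y x.1)ᴴ by simp only [Matrix.mul_assoc], hU,
      Matrix.mul_one]
  have hWl (x) : (W x)ᴴ * ρ * W x = l x.1 • (1 : Matrix (R x.1) (R x.1) ℂ) := by
    simp only [W, conjTranspose_mul]
    rw [show (U x.1 x.2)ᴴ * (Y x.1)ᴴ * ρ * (Y x.1 * U x.1 x.2)
      = (U x.1 x.2)ᴴ * ((Y x.1)ᴴ * ρ * Y x.1) * U x.1 x.2 by simp only [Matrix.mul_assoc], hl,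
      Matrix.mul_smul, Matrix.smul_mul, Matrix.mul_one, hU']
  -- `l j * |R j|` spread over the `|R j| ^ 2` Pauli operators.
  let p (x : Σ j, R j × R j) : ℝ := l x.1 / Fintype.card (R x.1)
  let τ (x : Σ j, R j × R j) : Matrix (A × E) (A × E) ℂ :=
    ampliate A (ε x.1) ((1 / (Fintype.card (F x.1) : ℂ)) • steeredState (W x))
  let T (x : Σ j, R j × R j) : Matrix (B × E) (B × E) ℂ :=
    ampliate B (ε x.1) ((l x.1)⁻¹ • compress (W x) Λ)
  have hp1 : ∑ x, p x = 1 := by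
    rw [Fintype.sum_sigma, ← hl1]
    refine Finset.sum_congr rfl fun j _ => ?_
    have := hR j
    change ∑ _q : R j × R j, l j / Fintype.card (R j) = _
    rw [Finset.sum_const, Finset.card_univ, Fintype.card_prod, nsmul_eq_mul, Nat.cast_mul]
    field_simp
  have hamp1 (j : J) : ampliate B (ε j) (1 : Matrix (B × R j) (B × R j) ℂ) = 1 := by
    rw [← one_kronecker_one, ampliate_kronecker_one, one_kronecker_one]
  have hτ (x) : (τ x).PosSemidef :=
    posSemidef_ampliate _ ((posSemidef_steeredState _).smul (by positivity))
  have hm (x) : traceOutLeft (τ x) = (1 / (Fintype.card E : ℂ)) • (1 : Matrix E E ℂ) := by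
    refine traceOutLeft_ampliate _ ?_
    have h := traceOutLeft_steeredState (hW x)
    ext k k'
    have hk := congrFun (congrFun h k) k'
    simp only [traceOutLeft, of_apply, Matrix.smul_apply, smul_eq_mul] at hk ⊢
    rw [← Finset.mul_sum, hk, hcard x.1]
    ring
  have hT (x) : (T x).PosSemidef :=
    posSemidef_ampliate _ (posSemidef_real_smul (posSemidef_compress _ hΛ.nonneg)
      (inv_nonneg.2 (hl0 _)))
  have hT1 (x) : (1 - T x).PosSemidef := by
    have e : 1 - T x = ampliate B (ε x.1) (1 - (l x.1)⁻¹ • compress (W x) Λ) := by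
      rw [map_sub, hamp1]
    rw [e]
    refine posSemidef_ampliate _ ?_
    -- On a block of eigenvalue zero, `0⁻¹ = 0` makes the effect vanish.
    rcases eq_or_ne (l x.1) 0 with h0 | h0
    · rw [h0, _root_.inv_zero, zero_smul, sub_zero]; exact PosSemidef.one
    · have := posSemidef_real_smul (posSemidef_smul_one_sub_compress (hWl x) hΛ) (inv_nonneg.2 (hl0 x.1))
      rwa [smul_sub, smul_smul, inv_mul_cancel₀ h0, one_smul] at this
  have hpT (x) : p x • T x
      = ampliate B (ε x.1) ((Fintype.card (R x.1) : ℂ)⁻¹ • compress (W x) Λ) := by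
    have h : p x • T x = ampliate B (ε x.1) (p x • (l x.1)⁻¹ • compress (W x) Λ) :=
      (LinearMap.map_smul_of_tower _ _ _).symm
    have e : p x * (l x.1)⁻¹ = (Fintype.card (R x.1) : ℝ)⁻¹ * (l x.1 * (l x.1)⁻¹) := by
      simp only [p]; ring
    rw [h, smul_smul, e, mul_smul, smul_compress_eq (hWl x) hΛ, ← Complex.coe_smul]
    simp
  have hmean : ∑ x, p x • T x = (1 / (M : ℝ)) • (1 : Matrix (B × E) (B × E) ℂ) := by
    have hblock (j : J) : ∑ q, p ⟨j, q⟩ • T ⟨j, q⟩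
        = traceOutRight (compress (Y j) Λ) ⊗ₖ (1 : Matrix E E ℂ) := by
      have h := sum_conj_design (hU2 j) (compress (Y j) Λ)
      simp only [← compress_mul] at h
      have hc : (Fintype.card (R j) : ℂ) ≠ 0 := Nat.cast_ne_zero.2 Fintype.card_ne_zero
      calc _ = ∑ q, ampliate B (ε j) ((Fintype.card (R j) : ℂ)⁻¹ • compress (Y j * U j q) Λ) :=
            Finset.sum_congr rfl fun q _ => hpT ⟨j, q⟩
        _ = _ := by
          rw [← map_sum, ← Finset.smul_sum, h, smul_smul, inv_mul_cancel₀ hc, one_smul,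
            ampliate_kronecker_one]
    rw [Fintype.sum_sigma]
    simp only [hblock]
    have h : ∑ j, traceOutRight (compress (Y j) Λ) ⊗ₖ (1 : Matrix E E ℂ)
        = traceOutLeft Λ ⊗ₖ (1 : Matrix E E ℂ) := by
      rw [← sum_traceOutRight_compress hY1]
      ext p q
      simp [Matrix.sum_apply, Finset.sum_mul]
    rw [h, hΛ.marginal, smul_kronecker, one_kronecker_one]
    ext p q
    simp
  have hscore : S = ∑ x, p x * (T x * tensorId E N (τ x)).trace.re := by
    rw [Fintype.sum_sigma]
    refine Finset.sum_congr rfl fun j _ => ?_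
    have h (q) : p ⟨j, q⟩ * (T ⟨j, q⟩ * tensorId E N (τ ⟨j, q⟩)).trace.re
        = (Fintype.card (R j) : ℝ)⁻¹ * (Fintype.card (R j) : ℝ)⁻¹ *
          (compress (Y j) Λ * compress (Y j) (choi N)).trace.re := by
      have hc : (Fintype.card (F j) : ℂ) ≠ 0 := by exact_mod_cast hF j
      have htr : (compress (W ⟨j, q⟩) Λ * compress (W ⟨j, q⟩) (choi N)).trace
          = (compress (Y j) Λ * compress (Y j) (choi N)).trace := by
        rw [trace_compress_mul_compress, trace_compress_mul_compress, hWW]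
      have e : ((p ⟨j, q⟩ • T ⟨j, q⟩) * tensorId E N (τ ⟨j, q⟩)).trace
          = (((Fintype.card (R j) : ℝ)⁻¹ * (Fintype.card (R j) : ℝ)⁻¹ : ℝ) : ℂ) *
            (compress (Y j) Λ * compress (Y j) (choi N)).trace := by
        rw [hpT]
        simp only [τ]
        rw [tensorId_ampliate, tensorId_smul, tensorId_steeredState, trace_ampliate_mul_ampliate,
          Matrix.mul_smul, Matrix.mul_smul, Matrix.smul_mul, trace_smul, trace_smul, trace_smul,
          htr]
        push_cast
        simp only [smul_eq_mul]
        field_simp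
      rw [Matrix.smul_mul, trace_smul] at e
      have := congrArg Complex.re e
      rwa [Complex.smul_re, smul_eq_mul, Complex.re_ofReal_mul] at this
    simp only [h, Finset.sum_const, Finset.card_univ, Fintype.card_prod, nsmul_eq_mul, Nat.cast_mul]
    have := hR j
    field_simp
  have hcardE : (Fintype.card E : ℝ) = ((∏ j, Fintype.card (R j) : ℕ) : ℝ) := by
    rw [Fintype.card_pi]
  have hSd : 2 * (Fintype.card B * Fintype.card E * Real.exp (-L - 1)) ≤ S := by
    rw [hcardE]
    refine le_of_mul_le_mul_left ?_ hJ
    calc _ = _ := by ring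
      _ ≤ _ := hd.trans hpinch
  have hS : 0 < S := pos_of_mul_pos_right (hS0.trans_le hpinch) hJ.le
  refine le_trans ?_ (le_sucEA_of_ensemble hN hM (fun x => div_nonneg (hl0 _) (Nat.cast_nonneg _))
    hp1 hτ hm hT hT1 hmean hscore hS hL hSd)
  rw [div_le_div_iff₀ (by positivity) (by positivity)]
  calc _ ≤ (Fintype.card J * S) * (2 * L) := by gcongr
    _ = _ := by ring

end Resolution

/-! ### The resolution by eigenspaces -/

section Spectral

open Matrix

variable {A B : Type*} [Fintype A] [DecidableEq A] [Fintype B] [DecidableEq B]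

omit [DecidableEq A] in
theorem nsFeasible_product {ρ : Matrix A A ℂ} (hρ : IsState ρ) {M : ℕ} (hM : 1 ≤ M) :
    NSFeasible M ρ ((1 / (M : ℂ)) • (ρ ⊗ₖ (1 : Matrix B B ℂ))) where
  marginal := by
    have h : traceOutLeft (ρ ⊗ₖ (1 : Matrix B B ℂ)) = 1 := by
      ext b b'
      have := hρ.trace_eq_one
      simp only [trace, diag_apply] at this
      change ∑ r, ρ r r * (1 : Matrix B B ℂ) b b' = _
      rw [← Finset.sum_mul, this, one_mul]
    have hs : traceOutLeft ((1 / (M : ℂ)) • (ρ ⊗ₖ (1 : Matrix B B ℂ)))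
        = (1 / (M : ℂ)) • traceOutLeft (ρ ⊗ₖ (1 : Matrix B B ℂ)) := by
      ext b b'
      exact (Finset.mul_sum _ _ _).symm
    rw [hs, h]
  nonneg := (hρ.posSemidef.kronecker PosSemidef.one).smul (by positivity)
  le := by
    have h : ρ ⊗ₖ (1 : Matrix B B ℂ) - (1 / (M : ℂ)) • (ρ ⊗ₖ (1 : Matrix B B ℂ))
        = (1 - 1 / (M : ℝ)) • (ρ ⊗ₖ (1 : Matrix B B ℂ)) := by
      rw [sub_smul, one_smul, ← Complex.coe_smul]
      simp
    rw [h]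
    refine posSemidef_real_smul (hρ.posSemidef.kronecker PosSemidef.one) (sub_nonneg.2 ?_)
    rw [one_div]
    exact inv_le_one_of_one_le₀ (by exact_mod_cast hM)

theorem trace_product_mul_choi {N : Matrix A A ℂ →ₗ[ℂ] Matrix B B ℂ} (hN : IsChannel N)
    {ρ : Matrix A A ℂ} (hρ : IsState ρ) : ((ρ ⊗ₖ (1 : Matrix B B ℂ)) * choi N).trace = 1 := by
  have h (i j : A) : (N (Matrix.single i j 1)).trace = if i = j then 1 else 0 := by
    rw [hN.tracePreserving]
    by_cases hij : i = j
    · subst hij; simp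
    · simp [hij, Matrix.trace_single_eq_of_ne]
  simp only [choi, Matrix.mul_sum, trace_sum, ← mul_kronecker_mul, trace_kronecker, Matrix.one_mul,
    h, mul_ite, mul_one, mul_zero, Finset.sum_ite_eq, Finset.mem_univ, if_true]
  refine Eq.trans (Finset.sum_congr rfl fun i _ => ?_) hρ.trace_eq_one
  rw [trace_mul_single]
  simp

theorem numEigenvalues_eq_card {ρ : Matrix A A ℂ} (hρ : ρ.IsHermitian) :
    numEigenvalues ρ = (Finset.univ.image hρ.eigenvalues).card := by
  rw [numEigenvalues, hρ.spectrum_eq_image_range,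
    Set.ncard_image_of_injective _ RCLike.ofReal_injective, ← Set.ncard_coe_finset]
  simp

/-- The blocks of the resolution are spanned by the columns of the eigenvector unitary of `ρ` that
belong to a common eigenvalue. -/
theorem le_sucEA_of_feasible {N : Matrix A A ℂ →ₗ[ℂ] Matrix B B ℂ} (hN : IsChannel N)
    {ρ : Matrix A A ℂ} (hρ : IsState ρ) {M : ℕ} (hM : 1 ≤ M) {Λ : Matrix (A × B) (A × B) ℂ}
    (hΛ : NSFeasible M ρ Λ) {L : ℝ} (hL : Real.exp 2 ≤ L) (hS0 : 0 < (Λ * choi N).trace.re)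
    (hd : 2 * (numEigenvalues ρ * (Fintype.card B * (Fintype.card A : ℝ) ^ numEigenvalues ρ *
      Real.exp (-L - 1))) ≤ (Λ * choi N).trace.re) :
    (Λ * choi N).trace.re / (2 * numEigenvalues ρ * L) ≤ sucEA N M := by
  have hH := hρ.posSemidef.1
  let J := {x // x ∈ Finset.univ.image hH.eigenvalues}
  let _ : Fintype J := inferInstanceAs (Fintype {x // x ∈ Finset.univ.image hH.eigenvalues})
  let _ : DecidableEq J := Classical.decEq J
  let g (i : A) : J := ⟨hH.eigenvalues i, Finset.mem_image_of_mem _ (Finset.mem_univ i)⟩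
  let R (j : J) := {i : A // g i = j}
  have hne (j : J) : Nonempty (R j) := by
    obtain ⟨i, -, hi⟩ := Finset.mem_image.1 j.2
    exact ⟨⟨i, Subtype.ext hi⟩⟩
  have hJ : Fintype.card J = numEigenvalues ρ := by
    rw [numEigenvalues_eq_card hH, Fintype.card_coe]
  obtain ⟨h1, h2⟩ := unitary_mul_conjTranspose hH.eigenvectorUnitary
  have key := eq_conj_diagonal_of_isHermitian hH
  set U := (hH.eigenvectorUnitary : Matrix A A ℂ)
  let Y (j : J) : Matrix A (R j) ℂ := U.submatrix id Subtype.val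
  have hUρ : Uᴴ * ρ * U = diagonal fun i => (hH.eigenvalues i : ℂ) := by
    conv_lhs => rw [key]
    rw [show Uᴴ * (U * diagonal (fun i => (hH.eigenvalues i : ℂ)) * Uᴴ) * U
      = (Uᴴ * U) * diagonal (fun i => (hH.eigenvalues i : ℂ)) * (Uᴴ * U) by
        simp only [Matrix.mul_assoc], h2, Matrix.one_mul, Matrix.mul_one]
  have hY (j : J) : (Y j)ᴴ * Y j = 1 := by
    have : (Y j)ᴴ * Y j = (Uᴴ * U).submatrix Subtype.val Subtype.val := rfl
    rw [this, h2, submatrix_one _ Subtype.val_injective]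
  have hY1 : ∑ j, Y j * (Y j)ᴴ = 1 := by
    rw [← h1]
    ext a a'
    rw [Matrix.sum_apply]
    exact Fintype.sum_fiberwise g fun i => U a i * Uᴴ i a'
  have hl (j : J) : (Y j)ᴴ * ρ * Y j = (j : ℝ) • (1 : Matrix (R j) (R j) ℂ) := by
    have : (Y j)ᴴ * ρ * Y j = (Uᴴ * ρ * U).submatrix Subtype.val Subtype.val := rfl
    rw [this, hUρ]
    ext k k'
    have hk : hH.eigenvalues k = j := congrArg Subtype.val k.2
    by_cases h : k = k'
    · subst h; simp [hk]
    · simp [h, Subtype.val_injective.ne h]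
  have hl1 : ∑ j : J, (j : ℝ) * Fintype.card (R j) = 1 := by
    have ht := hH.trace_eq_sum_eigenvalues
    rw [hρ.trace_eq_one] at ht
    have ht' : ∑ i, hH.eigenvalues i = 1 := by
      apply Complex.ofReal_injective
      simpa using ht.symm
    rw [← ht', ← Fintype.sum_fiberwise g]
    refine Finset.sum_congr rfl fun j _ => ?_
    have : ∑ k : R j, hH.eigenvalues k = ∑ _k : R j, (j : ℝ) :=
      Finset.sum_congr rfl fun k _ => congrArg Subtype.val k.2
    exact (by simp [mul_comm] : _ = ∑ _k : R j, (j : ℝ)).trans this.symm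
  have hl0 (j : J) : 0 ≤ (j : ℝ) := by
    obtain ⟨k⟩ := hne j
    have hk : hH.eigenvalues k = j := congrArg Subtype.val k.2
    rw [← hk]
    exact hρ.posSemidef.eigenvalues_nonneg _
  have hprod : ((∏ j, Fintype.card (R j) : ℕ) : ℝ)
      ≤ (Fintype.card A : ℝ) ^ numEigenvalues ρ := by
    rw [← hJ]
    exact_mod_cast Finset.prod_le_pow_card _ _ _ fun j _ => Fintype.card_subtype_le _
  rw [← hJ]
  refine le_sucEA_of_resolution hY hY1 hl0 hl hl1 hN hM hΛ hL hS0 (le_trans ?_ hd)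
  rw [hJ]
  gcongr

end Spectral

end QCoding

theorem mainTheorem3 {A B : Type*} [Fintype A] [DecidableEq A] [Fintype B] [DecidableEq B]
    (N : Matrix A A ℂ →ₗ[ℂ] Matrix B B ℂ) (hN : QCoding.IsChannel N)
    (ρ : Matrix A A ℂ) (hρ : QCoding.IsState ρ)
    (M : ℕ) (hM : 1 ≤ M)
    (v : ℕ) (hv : v = QCoding.numEigenvalues ρ)
    (hA : Real.exp 2 ≤ Real.log (Fintype.card A)) :
    1 / (2 * (v : ℝ) * Real.log (2 * (v : ℝ) * (M : ℝ) * Real.exp (v : ℝ) *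
        (Fintype.card A : ℝ) ^ v * (Fintype.card B : ℝ))) * QCoding.sucNS N M ρ
      ≤ QCoding.sucEA N M := by
  have hApos : 0 < Fintype.card A := by
    rcases Nat.eq_zero_or_pos (Fintype.card A) with h | h
    · rw [h, Nat.cast_zero, Real.log_zero] at hA
      exact absurd hA (not_le.2 (Real.exp_pos 2))
    · exact h
  obtain ⟨a⟩ := Fintype.card_pos_iff.1 hApos
  have hBpos : 0 < Fintype.card B := by
    refine Fintype.card_pos_iff.2 (not_isEmpty_iff.1 fun h => ?_)
    have := hN.tracePreserving (Matrix.single a a 1)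
    rw [Matrix.trace_single_eq_same] at this
    simp [Matrix.trace] at this
  have hvpos : 1 ≤ v := by
    rw [hv, QCoding.numEigenvalues_eq_card hρ.posSemidef.1]
    exact Finset.card_pos.2 ⟨_, Finset.mem_image_of_mem _ (Finset.mem_univ a)⟩
  have hA1 : (1 : ℝ) ≤ Fintype.card A := by exact_mod_cast hApos
  have hB1 : (1 : ℝ) ≤ Fintype.card B := by exact_mod_cast hBpos
  have hv1 : (1 : ℝ) ≤ v := by exact_mod_cast hvpos
  have hM1 : (1 : ℝ) ≤ M := by exact_mod_cast hM
  have hev : (1 : ℝ) ≤ Real.exp v := Real.one_le_exp (by positivity)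
  set X : ℝ := 2 * (v : ℝ) * (M : ℝ) * Real.exp (v : ℝ) *
    (Fintype.card A : ℝ) ^ v * (Fintype.card B : ℝ) with hX
  have hXpos : 0 < X := by positivity
  have hXA : (Fintype.card A : ℝ) ≤ X := by
    have h1 : (Fintype.card A : ℝ) ≤ (Fintype.card A : ℝ) ^ v :=
      le_self_pow₀ hA1 (by omega)
    calc (Fintype.card A : ℝ) = 1 * 1 * 1 * 1 * Fintype.card A * 1 := by ring
      _ ≤ X := by rw [hX]; gcongr; norm_num
  set L := Real.log X with hLdef
  have hL : Real.exp 2 ≤ L := hA.trans (Real.log_le_log (by positivity) hXA)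
  have hL0 : 0 < L := (Real.exp_pos 2).trans_le hL
  -- The factor `1 / X = exp (-L)` makes the penalty term at most `exp (-1 - v) / M`.
  have key (Λ : Matrix (A × B) (A × B) ℂ) (hΛ : QCoding.NSFeasible M ρ Λ)
      (ht : 1 / (M : ℝ) ≤ (Λ * QCoding.choi N).trace.re) :
      (Λ * QCoding.choi N).trace.re / (2 * v * L) ≤ QCoding.sucEA N M := by
    have hS0 : 0 < (Λ * QCoding.choi N).trace.re := lt_of_lt_of_le (by positivity) ht
    rw [hv]
    refine QCoding.le_sucEA_of_feasible hN hρ hM hΛ hL hS0 (le_trans ?_ ht)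
    rw [← hv, Real.exp_sub, Real.exp_neg, hLdef, Real.exp_log hXpos]
    have h1 : 2 * (v * (Fintype.card B * (Fintype.card A : ℝ) ^ v * (X⁻¹ / Real.exp 1)))
        = 1 / M * (1 / (Real.exp v * Real.exp 1)) := by
      rw [hX]; field_simp
    rw [h1]
    refine mul_le_of_le_one_right (by positivity) ?_
    rw [div_le_one (by positivity)]
    exact one_le_mul_of_one_le_of_one_le hev (Real.one_le_exp zero_le_one)
  have hfeas := QCoding.nsFeasible_product (B := B) hρ hM
  have hval : (((1 / (M : ℂ)) • (ρ ⊗ₖ (1 : Matrix B B ℂ))) * QCoding.choi N).trace.re = 1 / (M : ℝ) := by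
    rw [Matrix.smul_mul, Matrix.trace_smul, QCoding.trace_product_mul_choi hN hρ]
    simp
  rw [one_div_mul_eq_div, div_le_iff₀ (by positivity)]
  refine csSup_le ⟨_, _, hfeas, rfl⟩ ?_
  rintro _ ⟨Λ, hΛ, rfl⟩
  rw [← div_le_iff₀ (by positivity)]
  -- Operators whose value is below `1 / M` are dominated by the product operator.
  rcases le_total (1 / (M : ℝ)) (Λ * QCoding.choi N).trace.re with ht | ht
  · exact key Λ hΛ ht
  · refine le_trans ?_ (key _ hfeas hval.ge)
    exact div_le_div_of_nonneg_right (ht.trans hval.ge) (by positivity)
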